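/- Let $\Lambda$ be a finite set of sites with a metric $\mathrm{dist}$, let site $x$ carry the Hilbert space $\mathbb{C}^{d_x}$, and let an Abelian group $G$ act on-site by unitary representations $g\mapsto u_x(g)$. For a region $X\subseteq\Lambda$ and a character $\kappa:G\to U(1)$ let $\Pi^{(X)}_\kappa$ be the orthogonal projector onto the vectors with charge $\kappa$ in $X$, that is, those on which $\bigotimes_{x\in X}u_x(g)$ acts as the scalar $\kappa(g)$ for every $g\in G$. For pairwise disjoint regions $A,B,C$ and a state (density matrix) $\rho$ of the whole system put $$\Omega^{(AB|C)}(\rho)=\sum_\kappa|\kappa\rangle\langle\kappa|^{(K_C)}\otimes\mathrm{tr}_{\overline{AB}}\big(\Pi^{(C)}_\kappa\rho\big),$$ where $K_C$ is a register whose orthonormal basis is labelled by the charges occurring in $C$ and the trace is over all sites outside $A\cup B$. This is regarded as a bipartite state relative to the partition $AK_C|B$, and $\xrightarrow{\mathrm{LOCC}}$ denotes convertibility by finitely many rounds of local operations and classical communication between the two parties. For a measure of entanglement $E$ (a function of bipartite states that does not increase under LOCC), the SPT-entanglement of $\rho$ between $A$ and $B$ relative to $C$ is $E(\Omega^{(AB|C)}(\rho))$.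 Let $A_l,B_l$ be the balls of radius $l$ about $A,B$, i.e. the sets of sites at distance at most $l$ from some site of $A$, resp. $B$; let $\tilde C_l=C\setminus(A_l\cup B_l)$ and $D=\Lambda\setminus(A\cup B\cup C)$. A symmetric circuit is a product of finitely many layers, each layer being a product of unitaries that act on pairwise non-overlapping regions and commute with the global symmetry $\bigotimes_x u_x(g)$ for all $g\in G$; its range is its depth times the maximal diameter of the regions on which its unitaries act. **Theorem.** Let $A,B,C$ be pairwise disjoint regions, and let $\rho_1,\rho_2$ be states such that $\rho_2=V\rho_1V^\dagger$ for a symmetric circuit $V$ of range at most $R$. Suppose that each $\rho_i$ ($i=1,2$) satisfies the homogeneity condition: for some $l>2R$ the balls $A_l$ and $B_l$ are disjoint and $$\Omega^{(AB|C)}(\rho_i)\xrightarrow{\mathrm{LOCC}}\Omega^{(A_lB_l|\tilde C_l)}(\rho_i).$$ Suppose also that every site of $C$ is at distance more than $2R$ from every site of $D$ (no condition if $D$ is empty). Then $$\Omega^{(AB|C)}(\rho_1)\xrightarrow{\mathrm{LOCC}}\Omega^{(AB|C)}(\rho_2)\quad\text{and}\quad\Omega^{(AB|C)}(\rho_2)\xrightarrow{\mathrm{LOCC}}\Omega^{(AB|C)}(\rho_1).$$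 In particular, for every measure of entanglement $E$, the SPT-entanglements of $\rho_1$ and $\rho_2$ between $A$ and $B$ relative to $C$ are equal: $E(\Omega^{(AB|C)}(\rho_1))=E(\Omega^{(AB|C)}(\rho_2))$. -/

import Mathlib

open scoped Matrix Kronecker ComplexOrder

universe u

noncomputable section

/-! ### Bipartite systems and LOCC -/

section LOCC

variable {α' β' : Type u} [Fintype α'] [DecidableEq α'] [Fintype β'] [DecidableEq β']

/-- `IsLOCC Φ`: the map `Φ`, from operators on `ℂ^α ⊗ ℂ^β` to operators on `ℂ^α' ⊗ ℂ^β'`, is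
implemented by a protocol of finitely many rounds of local operations and classical communication.
In each round one of the two parties performs a local measurement with finitely many outcomes `j`
and Kraus operators `K j`, `∑ j, (K j)ᴴ * K j = 1` (the system of this party after the measurement
may depend on `j`), and announces the outcome, on which the rest of the protocol may depend. -/
inductive IsLOCC : ∀ {α β : Type u} [Fintype α] [DecidableEq α] [Fintype β] [DecidableEq β],
    (Matrix (α × β) (α × β) ℂ → Matrix (α' × β') (α' × β') ℂ) → Prop
  | done : IsLOCC (α := α') (β := β') id
  | alice {α β : Type u} [Fintype α] [DecidableEq α] [Fintype β] [DecidableEq β]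
      {J : Type u} [Fintype J] (γ : J → Type u) [∀ j, Fintype (γ j)] [∀ j, DecidableEq (γ j)]
      (K : ∀ j, Matrix (γ j) α ℂ) (hK : ∑ j, (K j)ᴴ * K j = 1)
      (Φ : ∀ j, Matrix (γ j × β) (γ j × β) ℂ → Matrix (α' × β') (α' × β') ℂ)
      (hΦ : ∀ j, IsLOCC (Φ j)) :
      IsLOCC (α := α) (β := β) fun σ =>
        ∑ j, Φ j ((K j ⊗ₖ (1 : Matrix β β ℂ)) * σ * (K j ⊗ₖ (1 : Matrix β β ℂ))ᴴ)
  | bob {α β : Type u} [Fintype α] [DecidableEq α] [Fintype β] [DecidableEq β]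
      {J : Type u} [Fintype J] (γ : J → Type u) [∀ j, Fintype (γ j)] [∀ j, DecidableEq (γ j)]
      (K : ∀ j, Matrix (γ j) β ℂ) (hK : ∑ j, (K j)ᴴ * K j = 1)
      (Φ : ∀ j, Matrix (α × γ j) (α × γ j) ℂ → Matrix (α' × β') (α' × β') ℂ)
      (hΦ : ∀ j, IsLOCC (Φ j)) :
      IsLOCC (α := α) (β := β) fun σ =>
        ∑ j, Φ j (((1 : Matrix α α ℂ) ⊗ₖ K j) * σ * ((1 : Matrix α α ℂ) ⊗ₖ K j)ᴴ)

/-- `σ → τ` by LOCC. -/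
def LOCCConvertible {α β : Type u} [Fintype α] [DecidableEq α] [Fintype β] [DecidableEq β]
    (σ : Matrix (α × β) (α × β) ℂ) (τ : Matrix (α' × β') (α' × β') ℂ) : Prop :=
  ∃ Φ : Matrix (α × β) (α × β) ℂ → Matrix (α' × β') (α' × β') ℂ, IsLOCC Φ ∧ Φ σ = τ

end LOCC

/-- Density matrices: positive semidefinite, of trace one. -/
def IsState {ι : Type*} [Fintype ι] (ρ : Matrix ι ι ℂ) : Prop :=
  ρ.PosSemidef ∧ ρ.trace = 1

/-- A (candidate) measure of bipartite entanglement: an extended real for every operator on a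
tensor product of two finite-dimensional systems. -/
abbrev BipartiteFunctional : Type (u + 1) :=
  ∀ (α β : Type u) [Fintype α] [DecidableEq α] [Fintype β] [DecidableEq β],
    Matrix (α × β) (α × β) ℂ → EReal

/-- A measure of entanglement does not increase when a state is transformed by LOCC. -/
def IsEntanglementMeasure (E : BipartiteFunctional.{u}) : Prop :=
  ∀ (α β α' β' : Type u) [Fintype α] [DecidableEq α] [Fintype β] [DecidableEq β]
    [Fintype α'] [DecidableEq α'] [Fintype β'] [DecidableEq β']
    (σ : Matrix (α × β) (α × β) ℂ) (τ : Matrix (α' × β') (α' × β') ℂ),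
    IsState σ → IsState τ → LOCCConvertible σ τ → E α' β' τ ≤ E α β σ

/-! ### Lattice systems with an on-site symmetry

`Λ` is the finite set of sites, with its distance, and the site `x` has the Hilbert space
`ℂ^(d x)`. -/

section Lattice

variable {Λ : Type u} [Fintype Λ] [DecidableEq Λ]

/-- The index set of the product basis of the region `X`. -/
abbrev Config (d : Λ → ℕ) (X : Finset Λ) : Type u := (x : {x // x ∈ X}) → Fin (d x)

/-- The index set of the product basis of the whole system. -/
abbrev FullConfig (d : Λ → ℕ) : Type u := (x : Λ) → Fin (d x)

/-- The tensor product of one operator for each site. -/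
def siteTensor {d : Λ → ℕ} (M : ∀ x, Matrix (Fin (d x)) (Fin (d x)) ℂ) :
    Matrix (FullConfig d) (FullConfig d) ℂ :=
  Matrix.of fun s t => ∏ x, M x (s x) (t x)

lemma siteTensor_mul {d : Λ → ℕ} (M N : ∀ x, Matrix (Fin (d x)) (Fin (d x)) ℂ) :
    siteTensor M * siteTensor N = siteTensor fun x => M x * N x := by
  ext s t
  simp only [siteTensor, Matrix.mul_apply, Matrix.of_apply]
  rw [Finset.prod_univ_sum, Fintype.piFinset_univ]
  exact Finset.sum_congr rfl fun r _ => Finset.prod_mul_distrib.symm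

/-- The operator `N ⊗ 1` on the whole system, for an operator `N` on the region `X`. -/
def embedRegion {d : Λ → ℕ} (X : Finset Λ) (N : Matrix (Config d X) (Config d X) ℂ) :
    Matrix (FullConfig d) (FullConfig d) ℂ :=
  Matrix.of fun s t =>
    if ∀ x, x ∉ X → s x = t x then N (fun x => s x) (fun x => t x) else 0

/-- The configuration of the whole system that is `a` on `A`, `b` on `B` and `e` elsewhere. -/
def glue {d : Λ → ℕ} (A B : Finset Λ) (a : Config d A) (b : Config d B)
    (e : Config d (A ∪ B)ᶜ) : FullConfig d := fun x =>
  if hA : x ∈ A then a ⟨x, hA⟩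
  else if hB : x ∈ B then b ⟨x, hB⟩
  else e ⟨x, by simp [hA, hB]⟩

/-- The partial trace over all sites except those in the disjoint regions `A` and `B`. -/
def reduceTo {d : Λ → ℕ} (A B : Finset Λ) (M : Matrix (FullConfig d) (FullConfig d) ℂ) :
    Matrix (Config d A × Config d B) (Config d A × Config d B) ℂ :=
  Matrix.of fun p q =>
    ∑ e : Config d (A ∪ B)ᶜ, M (glue A B p.1 p.2 e) (glue A B q.1 q.2 e)

variable {G : Type u} [CommGroup G] {d : Λ → ℕ}

/-- The action of `g` on the sites in `X` (and the identity on the other sites), for an on-site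
unitary representation `U`. -/
def regionSymmetry (U : ∀ x, G →* Matrix.unitaryGroup (Fin (d x)) ℂ) (X : Finset Λ) (g : G) :
    Matrix (FullConfig d) (FullConfig d) ℂ :=
  siteTensor fun x => if x ∈ X then (U x g : Matrix (Fin (d x)) (Fin (d x)) ℂ) else 1

/-- The vectors with charge `κ` in the region `X`: every `g` acts on `X` as the scalar `κ g`. -/
def chargeSpace (U : ∀ x, G →* Matrix.unitaryGroup (Fin (d x)) ℂ) (X : Finset Λ)
    (κ : G →* Circle) : Submodule ℂ (EuclideanSpace ℂ (FullConfig d)) :=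
  ⨅ g : G, Module.End.eigenspace (Matrix.toEuclideanLin (regionSymmetry U X g)) (κ g : ℂ)

/-- The matrix of the orthogonal projection onto the vectors with charge `κ` in `X`. -/
def chargeProj (U : ∀ x, G →* Matrix.unitaryGroup (Fin (d x)) ℂ) (X : Finset Λ)
    (κ : G →* Circle) : Matrix (FullConfig d) (FullConfig d) ℂ :=
  (Matrix.toEuclideanCLM (n := FullConfig d) (𝕜 := ℂ)).symm (chargeSpace U X κ).starProjection

/-- The charges that occur in the region `X`; they label the orthonormal basis of the register
that keeps the total charge of `X`. -/
def Charge (U : ∀ x, G →* Matrix.unitaryGroup (Fin (d x)) ℂ) (X : Finset Λ) : Type u :=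
  {κ : G →* Circle // chargeSpace U X κ ≠ ⊥}

lemma regionSymmetry_commute (U : ∀ x, G →* Matrix.unitaryGroup (Fin (d x)) ℂ) (X : Finset Λ)
    (g h : G) : Commute (regionSymmetry U X g) (regionSymmetry U X h) := by
  have key : ∀ a b : G, regionSymmetry U X a * regionSymmetry U X b
      = regionSymmetry U X (a * b) := by
    intro a b
    rw [regionSymmetry, regionSymmetry, siteTensor_mul, regionSymmetry]
    congr 1
    funext x
    by_cases hx : x ∈ X <;> simp [hx]
  rw [Commute, SemiconjBy, key, key, mul_comm]

instance (U : ∀ x, G →* Matrix.unitaryGroup (Fin (d x)) ℂ) (X : Finset Λ) :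
    Finite (Charge U X) := by
  have h1 := Module.End.independent_iInf_maxGenEigenspace_of_forall_mapsTo
    (fun g : G => (Matrix.toEuclideanLin (regionSymmetry U X g) :
      Module.End ℂ (EuclideanSpace ℂ (FullConfig d)))) (by
    intro g h φ
    apply Module.End.mapsTo_maxGenEigenspace_of_comm
    change _ * _ = _ * _
    apply LinearMap.ext
    intro v
    have := regionSymmetry_commute U X h g
    simp only [Module.End.mul_apply, Matrix.toLpLin_apply, Matrix.mulVec_mulVec, this.eq])
  have h2 := h1.comp (f := fun (κ : G →* Circle) (g : G) => (κ g : ℂ)) (by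
    intro κ κ' h
    ext g
    exact congrFun h g)
  have h3 : iSupIndep (chargeSpace U X) := h2.mono fun κ =>
    iInf_mono fun g => Module.End.genEigenspace_le_maximal _ _ _
  exact (WellFoundedGT.finite_ne_bot_of_iSupIndep h3).to_subtype

instance (U : ∀ x, G →* Matrix.unitaryGroup (Fin (d x)) ℂ) (X : Finset Λ) :
    Fintype (Charge U X) := Fintype.ofFinite _

instance (U : ∀ x, G →* Matrix.unitaryGroup (Fin (d x)) ℂ) (X : Finset Λ) :
    DecidableEq (Charge U X) := Classical.decEq _

/-- `Ω^(AB|C)(ρ) = ∑ κ, |κ⟩⟨κ| ⊗ tr_{outside AB} (Π_κ^(C) ρ)`, the joint state of the regions `A`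
and `B` and of the register of the total charge in `C`, as a bipartite state with the register and
`A` on one side and `B` on the other side. -/
def Omega (U : ∀ x, G →* Matrix.unitaryGroup (Fin (d x)) ℂ) (A B C : Finset Λ)
    (ρ : Matrix (FullConfig d) (FullConfig d) ℂ) :
    Matrix ((Charge U C × Config d A) × Config d B) ((Charge U C × Config d A) × Config d B) ℂ :=
  Matrix.of fun p q =>
    if p.1.1 = q.1.1 then
      reduceTo A B (chargeProj U C p.1.1.val * ρ) (p.1.2, p.2) (q.1.2, q.2)
    else 0

/-- The SPT-entanglement of `ρ` between `A` and `B` relative to `C`, quantified by `E`. -/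
def sptEntanglement (E : BipartiteFunctional.{u})
    (U : ∀ x, G →* Matrix.unitaryGroup (Fin (d x)) ℂ) (A B C : Finset Λ)
    (ρ : Matrix (FullConfig d) (FullConfig d) ℂ) : EReal :=
  E (Charge U C × Config d A) (Config d B) (Omega U A B C ρ)

/-! ### Symmetric circuits -/

/-- A unitary on a region of the system, invariant under the symmetry. -/
structure SymmetricGate (U : ∀ x, G →* Matrix.unitaryGroup (Fin (d x)) ℂ) where
  region : Finset Λ
  op : Matrix (Config d region) (Config d region) ℂ
  unitary : op ∈ Matrix.unitaryGroup (Config d region) ℂ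
  symm : ∀ g : G, Commute (embedRegion region op) (regionSymmetry U Finset.univ g)

/-- One layer of a circuit: gates on pairwise non-overlapping regions. -/
structure SymmetricLayer (U : ∀ x, G →* Matrix.unitaryGroup (Fin (d x)) ℂ) where
  gates : List (SymmetricGate U)
  disjoint : gates.Pairwise fun a b => Disjoint a.region b.region

/-- The unitary of a layer: the product of its gates. -/
def SymmetricLayer.toMatrix {U : ∀ x, G →* Matrix.unitaryGroup (Fin (d x)) ℂ}
    (L : SymmetricLayer U) : Matrix (FullConfig d) (FullConfig d) ℂ :=
  (L.gates.map fun a => embedRegion a.region a.op).prod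

/-- The unitary of a circuit, given as the list of its layers. -/
def circuitMatrix {U : ∀ x, G →* Matrix.unitaryGroup (Fin (d x)) ℂ}
    (V : List (SymmetricLayer U)) : Matrix (FullConfig d) (FullConfig d) ℂ :=
  (V.map SymmetricLayer.toMatrix).prod

/-- The range of a circuit is bounded by `R`: its depth times (a bound for) the diameters of the
regions of its gates is at most `R`. -/
def CircuitRangeLE [MetricSpace Λ] {U : ∀ x, G →* Matrix.unitaryGroup (Fin (d x)) ℂ}
    (V : List (SymmetricLayer U)) (R : ℝ) : Prop :=
  ∃ r : ℝ, 0 ≤ r ∧ (∀ L ∈ V, ∀ a ∈ L.gates, Metric.diam (a.region : Set Λ) ≤ r) ∧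
    (V.length : ℝ) * r ≤ R

open Classical in
/-- The ball of radius `l` about the region `X`. -/
def ballAbout [MetricSpace Λ] (X : Finset Λ) (l : ℝ) : Finset Λ :=
  Finset.univ.filter fun y => ∃ x ∈ X, dist y x ≤ l

/-- The homogeneity condition at radius `l`: the balls of radius `l` about `A` and `B` do not
overlap, and `Ω^(AB|C)(ρ) → Ω^(A_l B_l|C̃_l)(ρ)` by LOCC, where `C̃_l = C \ (A_l ∪ B_l)`. -/
def IsHomogeneousAt [MetricSpace Λ] (U : ∀ x, G →* Matrix.unitaryGroup (Fin (d x)) ℂ)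
    (A B C : Finset Λ) (l : ℝ) (ρ : Matrix (FullConfig d) (FullConfig d) ℂ) : Prop :=
  Disjoint (ballAbout A l) (ballAbout B l) ∧
    LOCCConvertible (Omega U A B C ρ)
      (Omega U (ballAbout A l) (ballAbout B l) (C \ (ballAbout A l ∪ ballAbout B l)) ρ)

end Lattice

end

/-!
Call a gate of the circuit `V` outer if it lies outside the backward light cones of the regions `A`
and `B`. Outer gates touch neither `A` nor `B`, and they can be moved past all other gates to the
end of the circuit. The gates in the two light cones do not interact, as the balls about `A` and
`B` are disjoint. Hence `V = W * VA * VB`, where `VA` acts on the ball `A_l`, `VB` acts on the ball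
`B_l`, and `W` is a product of symmetric gates outside `A ∪ B`
(`exists_circuit_factorization`). As `C` is far from the sites outside `A ∪ B ∪ C`, a gate of `W`
lies inside `C` or is disjoint from `C`, so it preserves the charge of `C`
(`commute_regionSymmetry_of_mem_gatesAvoiding`), and `W` has no effect on `Ω^(AB|C)`.

Two parties that share `Ω^(A_l B_l|C̃_l)(ρ₁)` can therefore produce `Ω^(AB|C)(ρ₂)`
(`LOCCConvertible.Omega_conj`). They apply `VA` and `VB`, measure the charges of `C ∩ A_l` and of
`C ∩ B_l`, and discard what lies outside `A` and `B`; Bob announces the charge that he found, and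
Alice multiplies both charges to the one in her register. This is correct because the charge of
`C` is the product of the charges of `C̃_l`, `C ∩ A_l` and `C ∩ B_l`, and `VA` and `VB` do not act
on `C̃_l`. With the homogeneity of `ρ₁` this gives the first conversion. The second one is the same
statement for the inverse circuit and the homogeneity of `ρ₂`, and an entanglement measure cannot
increase in either direction.

Charge projections are handled as matrices. They are determined by being the identity on operators
with the given charge (`chargeProj_mul_of_eigen`), they sum to one because commuting unitaries are
simultaneously diagonalizable (`iSup_chargeSpace`), and they act on their region only, by a
commutant argument (`LocalOn.of_commute`).
-/

/-! ### Operators supported on a region -/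

section Support

variable {Λ : Type u} [DecidableEq Λ] {d : Λ → ℕ}

/-- The configuration that is `a` on the region `X` and agrees with `s` elsewhere. -/
def patch (X : Finset Λ) (s : FullConfig d) (a : Config d X) : FullConfig d :=
  fun x => if h : x ∈ X then a ⟨x, h⟩ else s x

lemma patch_of_mem {X : Finset Λ} (s : FullConfig d) (a : Config d X) {x : Λ} (h : x ∈ X) :
    patch X s a x = a ⟨x, h⟩ := dif_pos h

lemma patch_of_notMem {X : Finset Λ} (s : FullConfig d) (a : Config d X) {x : Λ} (h : x ∉ X) :
    patch X s a x = s x := dif_neg h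

lemma patch_restrict (X : Finset Λ) (s : FullConfig d) (a : Config d X) :
    (fun x : {x // x ∈ X} => patch X s a x) = a := by
  funext x
  exact patch_of_mem s a x.2

variable [Fintype Λ]

lemma sum_ite_eq_off_region {X : Finset Λ} {β : Type*} [AddCommMonoid β] (s : FullConfig d)
    (F : FullConfig d → β) :
    ∑ t, (if ∀ x, x ∉ X → s x = t x then F t else 0) = ∑ a : Config d X, F (patch X s a) := by
  rw [← Finset.sum_filter]
  refine Finset.sum_bij' (fun t _ => fun x => t x) (fun a _ => patch X s a) ?_ ?_ ?_ ?_ ?_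
  · intros; exact Finset.mem_univ _
  · intro a _
    simp only [Finset.mem_filter, Finset.mem_univ, true_and]
    intro x hx
    rw [patch_of_notMem s a hx]
  · intro t ht
    simp only [Finset.mem_filter, Finset.mem_univ, true_and] at ht
    funext x
    by_cases hx : x ∈ X
    · rw [patch_of_mem _ _ hx]
    · rw [patch_of_notMem _ _ hx, ht x hx]
  · intro a _
    exact patch_restrict X s a
  · intro t ht
    simp only [Finset.mem_filter, Finset.mem_univ, true_and] at ht
    congr 1
    funext x
    by_cases hx : x ∈ X
    · rw [patch_of_mem _ _ hx]
    · rw [patch_of_notMem _ _ hx, ht x hx]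

lemma embedRegion_mul_apply (X : Finset Λ) (N : Matrix (Config d X) (Config d X) ℂ)
    {κ : Type*} (M : Matrix (FullConfig d) κ ℂ) (s : FullConfig d) (t : κ) :
    (embedRegion X N * M) s t = ∑ a, N (fun x => s x) a * M (patch X s a) t := by
  rw [Matrix.mul_apply]
  simp only [embedRegion, Matrix.of_apply, ite_mul, zero_mul]
  rw [sum_ite_eq_off_region s fun r => N (fun x => s x) (fun x => r x) * M r t]
  simp only [patch_restrict]

lemma mul_embedRegion_apply (X : Finset Λ) (N : Matrix (Config d X) (Config d X) ℂ)
    {κ : Type*} (M : Matrix κ (FullConfig d) ℂ) (s : κ) (t : FullConfig d) :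
    (M * embedRegion X N) s t = ∑ a, M s (patch X t a) * N a (fun x => t x) := by
  rw [Matrix.mul_apply]
  simp only [embedRegion, Matrix.of_apply, mul_ite, mul_zero]
  have h : ∀ r : FullConfig d, (∀ x, x ∉ X → r x = t x) ↔ ∀ x, x ∉ X → t x = r x :=
    fun r => ⟨fun h x hx => (h x hx).symm, fun h x hx => (h x hx).symm⟩
  simp only [h]
  rw [sum_ite_eq_off_region t fun r => M s r * N (fun x => r x) (fun x => t x)]
  simp only [patch_restrict]

lemma embedRegion_mul (X : Finset Λ) (N N' : Matrix (Config d X) (Config d X) ℂ) :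
    embedRegion X N * embedRegion X N' = embedRegion X (N * N') := by
  ext s t
  rw [embedRegion_mul_apply]
  simp only [embedRegion, Matrix.of_apply, patch_restrict, Matrix.mul_apply]
  have h : ∀ a : Config d X, (∀ x, x ∉ X → patch X s a x = t x) ↔ ∀ x, x ∉ X → s x = t x :=
    fun a => forall₂_congr fun x hx => by rw [patch_of_notMem s a hx]
  simp only [h]
  split_ifs <;> simp

lemma embedRegion_one (X : Finset Λ) :
    embedRegion X (1 : Matrix (Config d X) (Config d X) ℂ) = 1 := by
  ext s t
  simp only [embedRegion, Matrix.of_apply, Matrix.one_apply]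
  by_cases h : s = t
  · simp [h]
  · rw [if_neg h, ite_eq_right_iff]
    intro h1
    rw [if_neg]
    intro h2
    refine h (funext fun x => ?_)
    by_cases hx : x ∈ X
    · exact congrFun h2 ⟨x, hx⟩
    · exact h1 x hx

lemma embedRegion_conjTranspose (X : Finset Λ) (N : Matrix (Config d X) (Config d X) ℂ) :
    (embedRegion X N)ᴴ = embedRegion X Nᴴ := by
  ext s t
  simp only [embedRegion, Matrix.of_apply, Matrix.conjTranspose_apply, apply_ite star, star_zero]
  exact if_congr (forall₂_congr fun x _ => eq_comm) rfl rfl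

lemma embedRegion_sum (X : Finset Λ) {ι : Type*} (S : Finset ι)
    (N : ι → Matrix (Config d X) (Config d X) ℂ) :
    embedRegion X (∑ i ∈ S, N i) = ∑ i ∈ S, embedRegion X (N i) := by
  ext s t
  simp only [embedRegion, Matrix.of_apply, Matrix.sum_apply]
  split_ifs <;> simp

lemma embedRegion_injective [Nonempty (FullConfig d)] (X : Finset Λ) :
    Function.Injective (embedRegion (d := d) X) := by
  intro N N' h
  obtain ⟨s⟩ := ‹Nonempty (FullConfig d)›
  ext a b
  have h1 := congrFun (congrFun h (patch X s a)) (patch X s b)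
  have h2 : ∀ x, x ∉ X → patch X s a x = patch X s b x := fun x hx => by
    rw [patch_of_notMem _ _ hx, patch_of_notMem _ _ hx]
  simp only [embedRegion, Matrix.of_apply, patch_restrict] at h1
  rwa [if_pos h2, if_pos h2] at h1

lemma embedRegion_mul_of_disjoint {X Y : Finset Λ} (h : Disjoint X Y)
    (N : Matrix (Config d X) (Config d X) ℂ) (N' : Matrix (Config d Y) (Config d Y) ℂ)
    (s t : FullConfig d) :
    (embedRegion X N * embedRegion Y N') s t =
      if ∀ x, x ∉ X ∪ Y → s x = t x then
        N (fun x => s x) (fun x => t x) * N' (fun x => s x) (fun x => t x) else 0 := by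
  rw [embedRegion_mul_apply, Finset.sum_eq_single (fun x : {x // x ∈ X} => t x)]
  · have h1 : (fun x : {x // x ∈ Y} => patch X s (fun x => t x) x) = fun x : {x // x ∈ Y} => s x := by
      funext x
      exact patch_of_notMem _ _ (Finset.disjoint_right.1 h x.2)
    have h2 : (∀ x, x ∉ Y → patch X s (fun x => t x) x = t x) ↔
        ∀ x, x ∉ X ∪ Y → s x = t x := by
      refine forall_congr' fun x => ?_
      by_cases hx : x ∈ X
      · simp [hx, patch_of_mem]
      · simp [hx, patch_of_notMem]
    simp only [embedRegion, Matrix.of_apply, h1, h2, mul_ite, mul_zero]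
  · intro a _ ha
    rw [embedRegion, Matrix.of_apply, if_neg, mul_zero]
    intro h1
    refine ha (funext fun x => ?_)
    rw [← h1 x (Finset.disjoint_left.1 h x.2), patch_of_mem _ _ x.2]
  · simp

/-- The operator `M` of the whole system acts on the region `X` only: `M = N ⊗ 1`. -/
def LocalOn (X : Finset Λ) (M : Matrix (FullConfig d) (FullConfig d) ℂ) : Prop :=
  ∃ N, embedRegion X N = M

namespace LocalOn

variable {X Y : Finset Λ} {M M' : Matrix (FullConfig d) (FullConfig d) ℂ}

lemma one : LocalOn X (1 : Matrix (FullConfig d) (FullConfig d) ℂ) := ⟨1, embedRegion_one X⟩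

lemma mul (h : LocalOn X M) (h' : LocalOn X M') : LocalOn X (M * M') := by
  obtain ⟨N, rfl⟩ := h
  obtain ⟨N', rfl⟩ := h'
  exact ⟨_, (embedRegion_mul X N N').symm⟩

lemma conjTranspose (h : LocalOn X M) : LocalOn X Mᴴ := by
  obtain ⟨N, rfl⟩ := h
  exact ⟨_, (embedRegion_conjTranspose X N).symm⟩

lemma commute (h : LocalOn X M) (h' : LocalOn Y M') (hXY : Disjoint X Y) : Commute M M' := by
  obtain ⟨N, rfl⟩ := h
  obtain ⟨N', rfl⟩ := h'
  ext s t
  rw [embedRegion_mul_of_disjoint hXY, embedRegion_mul_of_disjoint hXY.symm, Finset.union_comm,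
    mul_comm]

lemma mono (h : LocalOn X M) (hXY : X ⊆ Y) : LocalOn Y M := by
  obtain ⟨N, rfl⟩ := h
  refine ⟨Matrix.of fun a b => if ∀ x : {x // x ∈ Y}, (x : Λ) ∉ X → a x = b x then
    N (fun x => a ⟨x, hXY x.2⟩) (fun x => b ⟨x, hXY x.2⟩) else 0, ?_⟩
  ext s t
  simp only [embedRegion, Matrix.of_apply, ← ite_and]
  refine if_congr ⟨fun h x hx => ?_, fun h => ⟨fun x hx => h x fun h' => hx (hXY h'),
    fun x hx => h x hx⟩⟩ rfl rfl
  by_cases hy : x ∈ Y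
  · exact h.2 ⟨x, hy⟩ hx
  · exact h.1 x hy

/-- The commutant of the operators on the complement of `X` consists of operators on `X`:
commuting with the matrix units of the complement forces `M` to be block diagonal with equal
blocks. -/
lemma of_commute [Nonempty (FullConfig d)]
    (h : ∀ M', LocalOn Xᶜ M' → Commute M M') : LocalOn X M := by
  obtain ⟨r⟩ := ‹Nonempty (FullConfig d)›
  -- Comparison of the entries of `M * E` and `E * M` for a matrix unit `E` of the complement.
  have key : ∀ (s t : FullConfig d) (c : Config d Xᶜ),
      M s (patch Xᶜ t c) =
        if (fun x : {x // x ∈ Xᶜ} => s x) = c then M (patch Xᶜ s fun x => t x) t else 0 := by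
    intro s t c
    have h1 := congrFun (congrFun (h _ ⟨Matrix.single c (fun x => t x) 1, rfl⟩).eq s) t
    rw [mul_embedRegion_apply, embedRegion_mul_apply] at h1
    rw [Finset.sum_eq_single c, Finset.sum_eq_single (fun x : {x // x ∈ Xᶜ} => t x)] at h1
    · simpa [Matrix.single_apply, eq_comm] using h1
    · intro b _ hb
      simp [hb.symm]
    · simp
    · intro b _ hb
      simp [hb.symm]
    · simp
  -- All blocks being equal, any configuration `r` of the complement serves to read one off.
  refine ⟨Matrix.of fun a b => M (patch X r a) (patch X r b), ?_⟩
  ext s t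
  have h1 := key s t fun x => t x
  have h2 : patch Xᶜ t (fun x => t x) = t := by
    funext x
    by_cases hx : x ∈ Xᶜ
    · rw [patch_of_mem _ _ hx]
    · rw [patch_of_notMem _ _ hx]
  have h3 : (fun x : {x // x ∈ Xᶜ} => s x) = (fun x : {x // x ∈ Xᶜ} => t x) ↔
      ∀ x, x ∉ X → s x = t x := by
    rw [funext_iff]
    simp
  have h4 : ∀ t : FullConfig d, patch X r (fun x => t x) = patch Xᶜ t fun x => r x := by
    intro t
    funext x
    by_cases hx : x ∈ X
    · rw [patch_of_mem _ _ hx, patch_of_notMem _ _ (by simpa using hx)]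
    · rw [patch_of_notMem _ _ hx, patch_of_mem _ _ (by simpa using hx)]
  have h5 := key (patch Xᶜ s fun x => r x) t fun x => r x
  have h6 : patch Xᶜ (patch Xᶜ s fun x => r x) (fun x => t x) = patch Xᶜ s fun x => t x := by
    funext x
    by_cases hx : x ∈ Xᶜ
    · rw [patch_of_mem _ _ hx, patch_of_mem _ _ hx]
    · rw [patch_of_notMem _ _ hx, patch_of_notMem _ _ hx, patch_of_notMem _ _ hx]
  rw [if_pos (patch_restrict _ _ _), h6] at h5
  rw [h2] at h1
  rw [embedRegion, Matrix.of_apply, Matrix.of_apply, h4, h4, h5, h1]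
  exact if_congr h3.symm rfl rfl

end LocalOn

end Support

/-! ### Charge projections -/

section Charge

variable {Λ : Type u} [Fintype Λ] {d : Λ → ℕ}

lemma siteTensor_one :
    siteTensor (fun x => (1 : Matrix (Fin (d x)) (Fin (d x)) ℂ)) = 1 := by
  ext s t
  simp only [siteTensor, Matrix.of_apply, Matrix.one_apply]
  rw [Fintype.prod_ite_zero]
  simp [funext_iff]

lemma siteTensor_conjTranspose (M : ∀ x, Matrix (Fin (d x)) (Fin (d x)) ℂ) :
    (siteTensor M)ᴴ = siteTensor fun x => (M x)ᴴ := by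
  ext s t
  simp [siteTensor]

variable [DecidableEq Λ]

lemma siteTensor_localOn {X : Finset Λ} {M : ∀ x, Matrix (Fin (d x)) (Fin (d x)) ℂ}
    (h : ∀ x, x ∉ X → M x = 1) : LocalOn X (siteTensor M) := by
  refine ⟨Matrix.of fun a b => ∏ x : {x // x ∈ X}, M x (a x) (b x), ?_⟩
  ext s t
  simp only [siteTensor, embedRegion, Matrix.of_apply]
  rw [← Finset.prod_mul_prod_compl X, ← Finset.prod_coe_sort X]
  have h1 : ∏ x ∈ Xᶜ, M x (s x) (t x) = if ∀ x, x ∉ X → s x = t x then 1 else 0 := by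
    rw [Finset.prod_congr rfl fun x hx => by
      rw [h x (by simpa using hx), Matrix.one_apply], Finset.prod_ite_zero]
    simp
  rw [h1, mul_ite, mul_one, mul_zero]

variable {G : Type u} [CommGroup G] (U : ∀ x, G →* Matrix.unitaryGroup (Fin (d x)) ℂ)
  (X : Finset Λ)

lemma regionSymmetry_mul (g h : G) :
    regionSymmetry U X g * regionSymmetry U X h = regionSymmetry U X (g * h) := by
  rw [regionSymmetry, regionSymmetry, siteTensor_mul, regionSymmetry]
  congr 1
  funext x
  by_cases hx : x ∈ X <;> simp [hx]

lemma regionSymmetry_one : regionSymmetry U X 1 = 1 := by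
  simp [regionSymmetry, siteTensor_one]

lemma regionSymmetry_conjTranspose (g : G) :
    (regionSymmetry U X g)ᴴ = regionSymmetry U X g⁻¹ := by
  rw [regionSymmetry, siteTensor_conjTranspose, regionSymmetry]
  congr 1
  funext x
  by_cases hx : x ∈ X
  · simp only [if_pos hx, map_inv]
    rfl
  · simp [hx]

lemma regionSymmetry_conjTranspose_mul (g : G) :
    (regionSymmetry U X g)ᴴ * regionSymmetry U X g = 1 := by
  rw [regionSymmetry_conjTranspose, regionSymmetry_mul, inv_mul_cancel, regionSymmetry_one]

lemma regionSymmetry_localOn (g : G) : LocalOn X (regionSymmetry U X g) :=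
  siteTensor_localOn fun _ hx => if_neg hx

lemma regionSymmetry_union {Y : Finset Λ} (h : Disjoint X Y) (g : G) :
    regionSymmetry U (X ∪ Y) g = regionSymmetry U X g * regionSymmetry U Y g := by
  rw [regionSymmetry, regionSymmetry, regionSymmetry, siteTensor_mul]
  congr 1
  funext x
  have := fun hx : x ∈ X => Finset.disjoint_left.1 h hx
  by_cases hx : x ∈ X <;> by_cases hy : x ∈ Y <;> simp_all

lemma mem_chargeSpace {κ : G →* Circle} {v : EuclideanSpace ℂ (FullConfig d)} :
    v ∈ chargeSpace U X κ ↔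
      ∀ g, Matrix.toEuclideanCLM (n := FullConfig d) (𝕜 := ℂ) (regionSymmetry U X g) v
        = (κ g : ℂ) • v := by
  simp only [chargeSpace, Submodule.mem_iInf, Module.End.mem_eigenspace_iff]
  rfl

lemma toEuclideanCLM_chargeProj (κ : G →* Circle) :
    Matrix.toEuclideanCLM (n := FullConfig d) (𝕜 := ℂ) (chargeProj U X κ)
      = (chargeSpace U X κ).starProjection :=
  StarAlgEquiv.apply_symm_apply _ _

lemma regionSymmetry_mul_chargeProj (κ : G →* Circle) (g : G) :
    regionSymmetry U X g * chargeProj U X κ = (κ g : ℂ) • chargeProj U X κ := by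
  apply EquivLike.injective (Matrix.toEuclideanCLM (n := FullConfig d) (𝕜 := ℂ))
  rw [map_mul, map_smul, toEuclideanCLM_chargeProj]
  ext1 v
  exact (mem_chargeSpace U X).1 (Submodule.starProjection_apply_mem _ v) g

variable {U X}

/-- The charge projection is the identity on its range; together with
`regionSymmetry_mul_chargeProj` this lets all further arguments about it be made with matrices. -/
lemma chargeProj_mul_of_eigen {κ : G →* Circle} {M : Matrix (FullConfig d) (FullConfig d) ℂ}
    (h : ∀ g, regionSymmetry U X g * M = (κ g : ℂ) • M) : chargeProj U X κ * M = M := by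
  apply EquivLike.injective (Matrix.toEuclideanCLM (n := FullConfig d) (𝕜 := ℂ))
  rw [map_mul, toEuclideanCLM_chargeProj]
  ext1 v
  refine Submodule.starProjection_eq_self_iff.2 ((mem_chargeSpace U X).2 fun g => ?_)
  have := congrArg (fun N => Matrix.toEuclideanCLM (n := FullConfig d) (𝕜 := ℂ) N v) (h g)
  simp only [map_mul, map_smul] at this
  exact this

variable (U X)

lemma chargeProj_mul_self (κ : G →* Circle) :
    chargeProj U X κ * chargeProj U X κ = chargeProj U X κ :=
  chargeProj_mul_of_eigen (regionSymmetry_mul_chargeProj U X κ)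

lemma chargeProj_conjTranspose (κ : G →* Circle) : (chargeProj U X κ)ᴴ = chargeProj U X κ := by
  apply EquivLike.injective (Matrix.toEuclideanCLM (n := FullConfig d) (𝕜 := ℂ))
  rw [← Matrix.star_eq_conjTranspose, map_star, toEuclideanCLM_chargeProj]
  exact isSelfAdjoint_starProjection _

variable {U X}

lemma commute_regionSymmetry_conjTranspose {M : Matrix (FullConfig d) (FullConfig d) ℂ}
    (h : ∀ g, Commute M (regionSymmetry U X g)) (g : G) :
    Commute Mᴴ (regionSymmetry U X g) := by
  have := congrArg Matrix.conjTranspose (h g⁻¹).eq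
  simp only [Matrix.conjTranspose_mul, regionSymmetry_conjTranspose, inv_inv] at this
  exact this.symm

lemma commute_chargeProj {κ : G →* Circle} {M : Matrix (FullConfig d) (FullConfig d) ℂ}
    (h : ∀ g, Commute M (regionSymmetry U X g)) : Commute M (chargeProj U X κ) := by
  have key : ∀ N : Matrix (FullConfig d) (FullConfig d) ℂ,
      (∀ g, Commute N (regionSymmetry U X g)) →
      chargeProj U X κ * (N * chargeProj U X κ) = N * chargeProj U X κ := fun N hN =>
    chargeProj_mul_of_eigen fun g => by
      rw [← mul_assoc, ← (hN g).eq, mul_assoc, regionSymmetry_mul_chargeProj, mul_smul_comm]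
  have h1 := key M h
  have h2 := congrArg Matrix.conjTranspose (key Mᴴ (commute_regionSymmetry_conjTranspose h))
  simp only [Matrix.conjTranspose_mul, Matrix.conjTranspose_conjTranspose,
    chargeProj_conjTranspose] at h2
  rw [Commute, SemiconjBy, ← h1, ← h2, mul_assoc]

lemma chargeProj_localOn [Nonempty (FullConfig d)] (κ : G →* Circle) :
    LocalOn X (chargeProj U X κ) :=
  LocalOn.of_commute fun _ hM => (commute_chargeProj fun g =>
    hM.commute (regionSymmetry_localOn U X g) disjoint_compl_left).symm

lemma chargeProj_mul_regionSymmetry (κ : G →* Circle) (g : G) :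
    chargeProj U X κ * regionSymmetry U X g = (κ g : ℂ) • chargeProj U X κ := by
  rw [← regionSymmetry_mul_chargeProj]
  exact (commute_chargeProj fun h => regionSymmetry_commute U X g h).eq.symm

lemma chargeProj_mul_of_ne {κ κ' : G →* Circle} (h : κ ≠ κ') :
    chargeProj U X κ * chargeProj U X κ' = 0 := by
  obtain ⟨g, hg⟩ := DFunLike.ne_iff.1 h
  have h1 : (κ g : ℂ) • (chargeProj U X κ * chargeProj U X κ')
      = (κ' g : ℂ) • (chargeProj U X κ * chargeProj U X κ') := by
    rw [← smul_mul_assoc, ← chargeProj_mul_regionSymmetry, mul_assoc,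
      regionSymmetry_mul_chargeProj, mul_smul_comm]
  rw [← sub_eq_zero, ← sub_smul, smul_eq_zero, sub_eq_zero] at h1
  exact h1.resolve_left fun h2 => hg (Circle.ext h2)

lemma chargeProj_eq_zero {κ : G →* Circle} (h : chargeSpace U X κ = ⊥) :
    chargeProj U X κ = 0 := by
  apply EquivLike.injective (Matrix.toEuclideanCLM (n := FullConfig d) (𝕜 := ℂ))
  rw [toEuclideanCLM_chargeProj, h, map_zero, Submodule.starProjection_bot]

variable (U X)

/-- A unitary operator is semisimple, as the orthogonal complement of an invariant subspace is
invariant. -/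
lemma regionSymmetry_isSemisimple (g : G) :
    Module.End.IsSemisimple (Matrix.toEuclideanLin (regionSymmetry U X g) :
      Module.End ℂ (EuclideanSpace ℂ (FullConfig d))) := by
  set T : Module.End ℂ (EuclideanSpace ℂ (FullConfig d)) :=
    Matrix.toEuclideanLin (regionSymmetry U X g) with hT
  have hinner : ∀ v w, inner ℂ (T v) (T w) = inner ℂ v w := by
    intro v w
    have h1 := congrArg (fun N => Matrix.toEuclideanCLM (n := FullConfig d) (𝕜 := ℂ) N w)
      (regionSymmetry_conjTranspose_mul U X g)
    rw [← Matrix.star_eq_conjTranspose] at h1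
    simp only [map_mul, map_star, map_one] at h1
    have h2 := ContinuousLinearMap.adjoint_inner_right
      (Matrix.toEuclideanCLM (n := FullConfig d) (𝕜 := ℂ) (regionSymmetry U X g)) v (T w)
    refine h2.symm.trans ?_
    exact congrArg (inner ℂ v) h1
  have hinj : Function.Injective T := by
    rw [injective_iff_map_eq_zero]
    intro v hv
    rw [← inner_self_eq_zero (𝕜 := ℂ), ← hinner, hv, inner_zero_left]
  rw [Module.End.isSemisimple_iff]
  intro p hp
  refine ⟨pᗮ, ?_, p.isCompl_orthogonal⟩
  have hmap : p.map T = p := by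
    refine Submodule.eq_of_le_of_finrank_eq (Submodule.map_le_iff_le_comap.2 hp) ?_
    exact (Submodule.equivMapOfInjective T hinj p).finrank_eq.symm
  intro v hv
  rw [Submodule.mem_comap, Submodule.mem_orthogonal]
  intro w hw
  rw [← hmap] at hw
  obtain ⟨w', hw', rfl⟩ := hw
  rw [hinner]
  exact (Submodule.mem_orthogonal _ _).1 hv w' hw'

/-- The commuting unitaries of the symmetry are simultaneously diagonalizable, and every joint
eigenvalue is a character with values in the unit circle. -/
lemma iSup_chargeSpace : ⨆ κ : G →* Circle, chargeSpace U X κ = ⊤ := by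
  have h1 := Module.End.iSup_iInf_maxGenEigenspace_eq_top_of_iSup_maxGenEigenspace_eq_top_of_commute
    (fun g : G => (Matrix.toEuclideanLin (regionSymmetry U X g) :
      Module.End ℂ (EuclideanSpace ℂ (FullConfig d))))
    (fun g h _ => by
      change _ * _ = _ * _
      apply LinearMap.ext
      intro v
      have := regionSymmetry_commute U X g h
      simp only [Module.End.mul_apply, Matrix.toLpLin_apply, Matrix.mulVec_mulVec, this.eq])
    fun g => Module.End.iSup_maxGenEigenspace_eq_top _
  rw [eq_top_iff, ← h1]
  refine iSup_le fun χ => ?_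
  simp only [fun g => (regionSymmetry_isSemisimple U X g).isFinitelySemisimple
    |>.maxGenEigenspace_eq_eigenspace]
  intro v hv
  by_cases hv0 : v = 0
  · rw [hv0]
    exact zero_mem _
  have hev : ∀ g, Matrix.toEuclideanCLM (n := FullConfig d) (𝕜 := ℂ) (regionSymmetry U X g) v
      = χ g • v := fun g =>
    Module.End.mem_eigenspace_iff.1 ((Submodule.mem_iInf _).1 hv g)
  have hone : χ 1 = 1 := by
    have := hev 1
    rw [regionSymmetry_one, map_one] at this
    exact smul_left_injective ℂ hv0 (by simpa using this.symm)
  have hmul : ∀ g h, χ (g * h) = χ g * χ h := by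
    intro g h
    have := hev (g * h)
    rw [← regionSymmetry_mul, map_mul, mul_apply_eq_comp, hev h, map_smul, hev g,
      smul_smul, mul_comm] at this
    exact smul_left_injective ℂ hv0 this.symm
  have hnorm : ∀ g, ‖χ g‖ = 1 := by
    intro g
    have h2 : star (χ g) * χ g = 1 := by
      have h3 := ContinuousLinearMap.adjoint_inner_right
        (Matrix.toEuclideanCLM (n := FullConfig d) (𝕜 := ℂ) (regionSymmetry U X g)) v
        (Matrix.toEuclideanCLM (n := FullConfig d) (𝕜 := ℂ) (regionSymmetry U X g) v)
      have h4 := congrArg (fun N => Matrix.toEuclideanCLM (n := FullConfig d) (𝕜 := ℂ) N v)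
        (regionSymmetry_conjTranspose_mul U X g)
      rw [← Matrix.star_eq_conjTranspose] at h4
      simp only [map_mul, map_star, map_one] at h4
      have h5 := (congrArg (inner ℂ v) h4).symm.trans h3
      rw [hev, inner_smul_left, inner_smul_right, ← mul_assoc] at h5
      exact (mul_right_cancel₀ (inner_self_ne_zero.2 hv0) ((one_mul _).trans h5)).symm
    have h6 : ‖χ g‖ * ‖χ g‖ = 1 := by
      calc ‖χ g‖ * ‖χ g‖ = ‖star (χ g) * χ g‖ := by rw [norm_mul, norm_star]
        _ = 1 := by rw [h2, norm_one]
    nlinarith [norm_nonneg (χ g)]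
  let κ : G →* Circle :=
    { toFun := fun g => ⟨χ g, mem_sphere_zero_iff_norm.2 (hnorm g)⟩
      map_one' := Circle.ext hone
      map_mul' := fun g h => Circle.ext (hmul g h) }
  exact Submodule.mem_iSup_of_mem κ ((mem_chargeSpace U X).2 hev)

lemma sum_chargeProj : ∑ κ : Charge U X, chargeProj U X κ.val = 1 := by
  apply EquivLike.injective (Matrix.toEuclideanCLM (n := FullConfig d) (𝕜 := ℂ))
  rw [map_one, ← sub_eq_zero, ← map_one (Matrix.toEuclideanCLM (n := FullConfig d) (𝕜 := ℂ)),
    ← map_sub]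
  set T := Matrix.toEuclideanCLM (n := FullConfig d) (𝕜 := ℂ)
    (∑ κ : Charge U X, chargeProj U X κ.val - 1) with hT
  have h : (⊤ : Submodule ℂ (EuclideanSpace ℂ (FullConfig d))) ≤
      LinearMap.ker 
        (T : EuclideanSpace ℂ (FullConfig d) →ₗ[ℂ] EuclideanSpace ℂ (FullConfig d)) := by
    rw [← iSup_chargeSpace U X]
    refine iSup_le fun κ v hv => ?_
    by_cases hκ : chargeSpace U X κ = ⊥
    · rw [hκ, Submodule.mem_bot] at hv
      rw [hv]
      exact zero_mem _
    have h1 : (∑ κ : Charge U X, chargeProj U X κ.val - 1) * chargeProj U X κ = 0 := by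
      rw [sub_mul, Finset.sum_mul, one_mul, sub_eq_zero]
      refine (Finset.sum_eq_single (⟨κ, hκ⟩ : Charge U X) (fun κ' _ hne => ?_) ?_).trans
        (chargeProj_mul_self U X κ)
      · exact chargeProj_mul_of_ne fun h => hne (Subtype.ext h)
      · exact fun h => absurd (Finset.mem_univ (α := Charge U X) _) h
    have h2 := congrArg (fun N => Matrix.toEuclideanCLM (n := FullConfig d) (𝕜 := ℂ) N v) h1
    simp only [map_mul, map_zero] at h2
    rw [mul_apply_eq_comp, toEuclideanCLM_chargeProj,
      Submodule.starProjection_eq_self_iff.2 hv] at h2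
    exact h2
  ext1 v
  exact h Submodule.mem_top

variable {U X}

/-- The charge of a union of disjoint regions is the product of the charges of the regions. -/
lemma chargeProj_union_mul {Y : Finset Λ} (h : Disjoint X Y) [Nonempty (FullConfig d)]
    (κ κ' : G →* Circle) :
    chargeProj U (X ∪ Y) (κ * κ') * (chargeProj U X κ * chargeProj U Y κ')
      = chargeProj U X κ * chargeProj U Y κ' := by
  refine chargeProj_mul_of_eigen fun g => ?_
  rw [regionSymmetry_union U X h, mul_assoc, ← mul_assoc (regionSymmetry U Y g),
    ((regionSymmetry_localOn U Y g).commute (chargeProj_localOn κ) h.symm).eq, mul_assoc,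
    regionSymmetry_mul_chargeProj, ← mul_assoc, regionSymmetry_mul_chargeProj, mul_smul_comm,
    smul_mul_assoc, smul_smul, mul_comm (κ' g : ℂ)]
  simp

end Charge

/-! ### Partial traces -/

section PartialTrace

variable {Λ : Type u} [DecidableEq Λ] {d : Λ → ℕ}

section Contraction

variable {A A' B B' : Finset Λ}

/-- A configuration of `A'`, given as a configuration of `A ⊆ A'` and one of the rest. -/
def splitConfig (hA : A ⊆ A') : Config d A × Config d (A' \ A) ≃ Config d A' where
  toFun p x := if h : (x : Λ) ∈ A then p.1 ⟨x, h⟩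
    else p.2 ⟨x, Finset.mem_sdiff.2 ⟨x.2, h⟩⟩
  invFun c := (fun x => c ⟨x, hA x.2⟩, fun x => c ⟨x, (Finset.mem_sdiff.1 x.2).1⟩)
  left_inv p := by
    ext x
    · simp
    · simp [(Finset.mem_sdiff.1 x.2).2]
  right_inv c := by
    ext x
    by_cases h : (x : Λ) ∈ A <;> simp [h]

/-- The contraction `1 ⊗ ⟨e|` of the system `A'` to its subsystem `A`. For all `e` together these
are the Kraus operators of the partial trace over `A' \ A`. -/
def contraction (hA : A ⊆ A') (e : Config d (A' \ A)) : Matrix (Config d A) (Config d A') ℂ :=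
  Matrix.of fun a c => if splitConfig hA (a, e) = c then 1 else 0

lemma sum_contraction (hA : A ⊆ A') :
    ∑ e : Config d (A' \ A), (contraction hA e)ᴴ * contraction hA e = 1 := by
  ext s t
  simp only [Matrix.sum_apply, Matrix.mul_apply, Matrix.conjTranspose_apply, contraction,
    Matrix.of_apply]
  rw [← Fintype.sum_prod_type_right (f := fun p : Config d A × Config d (A' \ A) =>
    star (if splitConfig hA p = s then (1 : ℂ) else 0) *
      if splitConfig hA p = t then (1 : ℂ) else 0),
    (splitConfig hA).sum_comp (fun c => star (if c = s then (1 : ℂ) else 0) *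
      if c = t then (1 : ℂ) else 0)]
  simp [apply_ite star, Matrix.one_apply, eq_comm]

lemma sum_contraction_mul {A A' : Finset Λ} (hA : A ⊆ A') {I : Type*} [Fintype I]
    {N : I → Matrix (Config d A') (Config d A') ℂ} (hN : ∑ i, (N i)ᴴ * N i = 1) :
    ∑ x : I × Config d (A' \ A),
      (contraction hA x.2 * N x.1)ᴴ * (contraction hA x.2 * N x.1) = 1 := by
  rw [Fintype.sum_prod_type, ← hN]
  refine Finset.sum_congr rfl fun i _ => ?_
  have h : ∀ e, (contraction hA e * N i)ᴴ * (contraction hA e * N i)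
      = (N i)ᴴ * ((contraction hA e)ᴴ * contraction hA e) * N i := fun e => by
    rw [Matrix.conjTranspose_mul]
    simp only [Matrix.mul_assoc]
  simp only [h]
  rw [← Finset.sum_mul, ← Finset.mul_sum, sum_contraction, mul_one]

lemma contraction_conj_apply (hA : A ⊆ A') (hB : B ⊆ B') (e : Config d (A' \ A))
    (e' : Config d (B' \ B)) (M : Matrix (Config d A' × Config d B') (Config d A' × Config d B') ℂ)
    (p q : Config d A × Config d B) :
    ((contraction hA e ⊗ₖ contraction hB e') * M * (contraction hA e ⊗ₖ contraction hB e')ᴴ) p q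
      = M (splitConfig hA (p.1, e), splitConfig hB (p.2, e'))
          (splitConfig hA (q.1, e), splitConfig hB (q.2, e')) := by
  simp [Matrix.mul_apply, contraction, Fintype.sum_prod_type, apply_ite (starRingEnd ℂ)]

end Contraction

variable [Fintype Λ]

section Glue

variable {A B : Finset Λ} (a : Config d A) (b : Config d B) (e : Config d (A ∪ B)ᶜ)

lemma patch_glue_left (a' : Config d A) : patch A (glue A B a b e) a' = glue A B a' b e := by
  funext x
  by_cases hx : x ∈ A <;> simp [patch, glue, hx]

lemma restrict_glue_left : (fun x : {x // x ∈ A} => glue A B a b e x) = a := by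
  funext x
  simp [glue]

lemma patch_glue_right (h : Disjoint A B) (b' : Config d B) :
    patch B (glue A B a b e) b' = glue A B a b' e := by
  funext x
  have := fun hx : x ∈ A => Finset.disjoint_left.1 h hx
  by_cases hx : x ∈ A <;> by_cases hx' : x ∈ B <;> simp_all [patch, glue]

lemma restrict_glue_right (h : Disjoint A B) :
    (fun x : {x // x ∈ B} => glue A B a b e x) = b := by
  funext x
  simp [glue, Finset.disjoint_right.1 h x.2]

lemma patch_glue_compl (e' : Config d (A ∪ B)ᶜ) :
    patch (A ∪ B)ᶜ (glue A B a b e) e' = glue A B a b e' := by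
  funext x
  by_cases hx : x ∈ A <;> by_cases hx' : x ∈ B <;> simp [patch, glue, hx, hx']

lemma restrict_glue_compl : (fun x : {x // x ∈ (A ∪ B)ᶜ} => glue A B a b e x) = e := by
  funext x
  have := x.2
  simp only [Finset.mem_compl, Finset.mem_union, not_or] at this
  simp [glue, this]

end Glue

variable {A B : Finset Λ}

lemma reduceTo_conjTranspose (M : Matrix (FullConfig d) (FullConfig d) ℂ) :
    reduceTo A B Mᴴ = (reduceTo A B M)ᴴ := by
  ext p q
  simp [reduceTo]

lemma reduceTo_zero : reduceTo A B (0 : Matrix (FullConfig d) (FullConfig d) ℂ) = 0 := by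
  ext p q
  simp [reduceTo]

lemma reduceTo_sum {ι : Type*} (S : Finset ι) (M : ι → Matrix (FullConfig d) (FullConfig d) ℂ) :
    reduceTo A B (∑ i ∈ S, M i) = ∑ i ∈ S, reduceTo A B (M i) := by
  ext p q
  simp only [reduceTo, Matrix.of_apply, Matrix.sum_apply]
  exact Finset.sum_comm

lemma reduceTo_embedRegion_left_mul (N : Matrix (Config d A) (Config d A) ℂ)
    (M : Matrix (FullConfig d) (FullConfig d) ℂ) :
    reduceTo A B (embedRegion A N * M) = (N ⊗ₖ 1) * reduceTo A B M := by
  ext p q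
  simp only [reduceTo, Matrix.of_apply, embedRegion_mul_apply, patch_glue_left,
    restrict_glue_left]
  rw [Matrix.mul_apply, Fintype.sum_prod_type]
  simp only [Matrix.of_apply, Matrix.kroneckerMap_apply, Matrix.one_apply, mul_ite, mul_one, mul_zero, ite_mul, zero_mul, Finset.sum_ite_eq,
    Finset.mem_univ, if_true]
  simp only [Finset.mul_sum]
  exact Finset.sum_comm

lemma reduceTo_embedRegion_right_mul (h : Disjoint A B) (N : Matrix (Config d B) (Config d B) ℂ)
    (M : Matrix (FullConfig d) (FullConfig d) ℂ) :
    reduceTo A B (embedRegion B N * M) = (1 ⊗ₖ N) * reduceTo A B M := by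
  ext p q
  simp only [reduceTo, Matrix.of_apply, embedRegion_mul_apply, patch_glue_right _ _ _ h,
    restrict_glue_right _ _ _ h]
  rw [Matrix.mul_apply, Fintype.sum_prod_type_right]
  simp only [Matrix.of_apply, Matrix.kroneckerMap_apply, Matrix.one_apply, one_mul, ite_mul, zero_mul, Finset.sum_ite_eq,
    Finset.mem_univ, if_true]
  simp only [Finset.mul_sum]
  exact Finset.sum_comm

/-- Operators on `A` and on `B` may be taken out of the partial trace. -/
lemma reduceTo_conj (h : Disjoint A B) (N : Matrix (Config d A) (Config d A) ℂ)
    (N' : Matrix (Config d B) (Config d B) ℂ) (M : Matrix (FullConfig d) (FullConfig d) ℂ) :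
    reduceTo A B (embedRegion A N * embedRegion B N' * M * (embedRegion A N * embedRegion B N')ᴴ)
      = (N ⊗ₖ N') * reduceTo A B M * (N ⊗ₖ N')ᴴ := by
  have key : ∀ M, reduceTo A B (embedRegion A N * embedRegion B N' * M)
      = (N ⊗ₖ N') * reduceTo A B M := by
    intro M
    rw [mul_assoc, reduceTo_embedRegion_left_mul, reduceTo_embedRegion_right_mul h, ← mul_assoc,
      ← Matrix.mul_kronecker_mul, mul_one, one_mul]
  rw [mul_assoc, key, mul_assoc]
  congr 1
  have := key Mᴴ
  rw [reduceTo_conjTranspose] at this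
  rw [← Matrix.conjTranspose_conjTranspose (reduceTo A B M), ← Matrix.conjTranspose_mul, ← this,
    ← reduceTo_conjTranspose, Matrix.conjTranspose_mul _ Mᴴ, Matrix.conjTranspose_conjTranspose]

/-- The partial trace is cyclic for operators on the region that is traced out. -/
lemma reduceTo_mul_comm {W : Matrix (FullConfig d) (FullConfig d) ℂ} (hW : LocalOn (A ∪ B)ᶜ W)
    (M : Matrix (FullConfig d) (FullConfig d) ℂ) :
    reduceTo A B (W * M) = reduceTo A B (M * W) := by
  obtain ⟨N, rfl⟩ := hW
  ext p q
  simp only [reduceTo, Matrix.of_apply, embedRegion_mul_apply, mul_embedRegion_apply,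
    restrict_glue_compl, patch_glue_compl]
  rw [Finset.sum_comm]
  exact Finset.sum_congr rfl fun e _ => Finset.sum_congr rfl fun e' _ => mul_comm _ _

section Nested

variable {A' B' : Finset Λ}

/-- A configuration of the sites outside `A ∪ B`, split into its parts in `A'`, in `B'` and
outside both. -/
def splitOutside (hA : A ⊆ A') (hB : B ⊆ B') (h : Disjoint A' B') :
    Config d (A ∪ B)ᶜ ≃ Config d (A' \ A) × Config d (B' \ B) × Config d (A' ∪ B')ᶜ where
  toFun e :=
    (fun x => e ⟨x, by
      have := Finset.mem_sdiff.1 x.2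
      have := fun hx : (x : Λ) ∈ B => Finset.disjoint_left.1 h this.1 (hB hx)
      simp_all⟩,
    fun x => e ⟨x, by
      have := Finset.mem_sdiff.1 x.2
      have := fun hx : (x : Λ) ∈ A => Finset.disjoint_right.1 h this.1 (hA hx)
      simp_all⟩,
    fun x => e ⟨x, Finset.compl_subset_compl.2 (Finset.union_subset_union hA hB) x.2⟩)
  invFun p x :=
    if hA : (x : Λ) ∈ A' then p.1 ⟨x, by have := x.2; simp_all⟩
    else if hB : (x : Λ) ∈ B' then p.2.1 ⟨x, by have := x.2; simp_all⟩
    else p.2.2 ⟨x, by simp [hA, hB]⟩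
  left_inv e := by
    funext x
    dsimp only
    split_ifs <;> rfl
  right_inv p := by
    ext x
    · simp [(Finset.mem_sdiff.1 x.2).1]
    · have h1 := (Finset.mem_sdiff.1 x.2).1
      simp [h1, Finset.disjoint_right.1 h h1]
    · have h1 := x.2
      rw [Finset.mem_compl, Finset.mem_union, not_or] at h1
      simp [h1]

lemma glue_splitConfig (hA : A ⊆ A') (hB : B ⊆ B') (h : Disjoint A' B') (a : Config d A)
    (b : Config d B) (e : Config d (A ∪ B)ᶜ) :
    glue A' B' (splitConfig hA (a, (splitOutside hA hB h e).1))
      (splitConfig hB (b, (splitOutside hA hB h e).2.1)) (splitOutside hA hB h e).2.2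
      = glue A B a b e := by
  funext x
  have h1 := fun hx : x ∈ A' => Finset.disjoint_left.1 h hx
  have h2 := fun hx : x ∈ A => hA hx
  have h3 := fun hx : x ∈ B => hB hx
  by_cases hxA : x ∈ A <;> by_cases hxB : x ∈ B <;> by_cases hxA' : x ∈ A' <;>
    by_cases hxB' : x ∈ B' <;> simp_all [glue, splitConfig, splitOutside]

/-- The partial trace to `A` and `B` is the one to `A' ⊇ A` and `B' ⊇ B`, followed by the partial
traces over `A' \ A` and `B' \ B`. -/
lemma sum_contraction_conj_reduceTo (hA : A ⊆ A') (hB : B ⊆ B') (h : Disjoint A' B')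
    (M : Matrix (FullConfig d) (FullConfig d) ℂ) :
    ∑ e : Config d (A' \ A), ∑ e' : Config d (B' \ B),
      (contraction hA e ⊗ₖ contraction hB e') * reduceTo A' B' M *
        (contraction hA e ⊗ₖ contraction hB e')ᴴ = reduceTo A B M := by
  ext p q
  simp only [Matrix.sum_apply, contraction_conj_apply]
  simp only [reduceTo, Matrix.of_apply]
  rw [← (splitOutside hA hB h).symm.sum_comp]
  simp only [Fintype.sum_prod_type]
  refine Finset.sum_congr rfl fun e _ => Finset.sum_congr rfl fun e' _ =>
    Finset.sum_congr rfl fun e'' _ => ?_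
  obtain ⟨r, hr⟩ := (splitOutside hA hB h).surjective (e, e', e'')
  rw [← hr, Equiv.symm_apply_apply, ← glue_splitConfig hA hB h, ← glue_splitConfig hA hB h, hr]

/-- Applying operators on `A'` and `B'` locally and then discarding `A' \ A` and `B' \ B` locally
is the same as applying them to the state of the whole system and reducing it to `A` and `B`. -/
lemma sum_contraction_mul_conj_reduceTo (hA : A ⊆ A') (hB : B ⊆ B') (h : Disjoint A' B')
    (NA : Matrix (Config d A') (Config d A') ℂ) (NB : Matrix (Config d B') (Config d B') ℂ)
    (KA : Config d (A' \ A) → Matrix (Config d A) (Config d A') ℂ)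
    (KB : Config d (B' \ B) → Matrix (Config d B) (Config d B') ℂ)
    (hKA : ∀ e, KA e = contraction hA e * NA) (hKB : ∀ e, KB e = contraction hB e * NB)
    (M : Matrix (FullConfig d) (FullConfig d) ℂ) :
    ∑ e, ∑ e', (KA e ⊗ₖ KB e') * reduceTo A' B' M * (KA e ⊗ₖ KB e')ᴴ
      = reduceTo A B (embedRegion A' NA * embedRegion B' NB * M *
          (embedRegion A' NA * embedRegion B' NB)ᴴ) := by
  rw [← sum_contraction_conj_reduceTo hA hB h, reduceTo_conj h]
  refine Finset.sum_congr rfl fun e _ => Finset.sum_congr rfl fun e' _ => ?_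
  rw [hKA, hKB, Matrix.mul_kronecker_mul, Matrix.conjTranspose_mul]
  simp only [Matrix.mul_assoc]

end Nested

end PartialTrace

/-! ### Protocols of local operations and classical communication -/

section RegisterState

variable {α β ι : Type u} [DecidableEq ι]

/-- The state `∑ k, |k⟩⟨k| ⊗ R k` of a classical register, held by Alice, and a bipartite
system. -/
def registerState (R : ι → Matrix (α × β) (α × β) ℂ) :
    Matrix ((ι × α) × β) ((ι × α) × β) ℂ :=
  Matrix.of fun p q => if p.1.1 = q.1.1 then R p.1.1 (p.1.2, p.2) (q.1.2, q.2) else 0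

lemma registerState_sum {J : Type*} (S : Finset J) (R : J → ι → Matrix (α × β) (α × β) ℂ) :
    registerState (fun k => ∑ j ∈ S, R j k) = ∑ j ∈ S, registerState (R j) := by
  ext p q
  simp only [registerState, Matrix.of_apply, Matrix.sum_apply]
  split_ifs <;> simp

variable [Fintype ι]

lemma registerState_eq_sum (R : ι → Matrix (α × β) (α × β) ℂ) :
    registerState R = ∑ k, (Matrix.single k k (1 : ℂ) ⊗ₖ R k).submatrix
      (Equiv.prodAssoc ι α β) (Equiv.prodAssoc ι α β) := by
  ext p q
  simp only [registerState, Matrix.of_apply, Matrix.sum_apply, Matrix.submatrix_apply,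
    Equiv.prodAssoc_apply, Matrix.kroneckerMap_apply, Matrix.single_apply, ite_mul, one_mul,
    zero_mul, ite_and, Finset.sum_ite_eq', Finset.mem_univ, if_true]

variable {α' β' ι' : Type u} [DecidableEq ι'] [Fintype α] [Fintype β] [Fintype ι']

lemma registerState_conj (k₀ : ι) (l : ι') (K : Matrix α' α ℂ) (L : Matrix β' β ℂ)
    (R : ι → Matrix (α × β) (α × β) ℂ) :
    ((Matrix.single l k₀ (1 : ℂ) ⊗ₖ K) ⊗ₖ L) * registerState R *
      ((Matrix.single l k₀ (1 : ℂ) ⊗ₖ K) ⊗ₖ L)ᴴ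
      = registerState fun l' => if l' = l then (K ⊗ₖ L) * R k₀ * (K ⊗ₖ L)ᴴ else 0 := by
  have h : (Matrix.single l k₀ (1 : ℂ) ⊗ₖ K) ⊗ₖ L
      = (Matrix.single l k₀ (1 : ℂ) ⊗ₖ (K ⊗ₖ L)).submatrix
        (Equiv.prodAssoc ι' α' β') (Equiv.prodAssoc ι α β) := by
    rw [← Matrix.kronecker_assoc]
    rfl
  rw [h, registerState_eq_sum, registerState_eq_sum, Finset.sum_eq_single l,
    Matrix.mul_sum, Matrix.sum_mul, Finset.sum_eq_single k₀]
  · rw [if_pos rfl, Matrix.submatrix_mul_equiv, Matrix.conjTranspose_submatrix,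
      Matrix.submatrix_mul_equiv, Matrix.conjTranspose_kronecker, ← Matrix.mul_kronecker_mul,
      ← Matrix.mul_kronecker_mul, Matrix.conjTranspose_single]
    simp
  · intro k _ hk
    rw [Matrix.submatrix_mul_equiv, ← Matrix.mul_kronecker_mul,
      Matrix.single_mul_single_of_ne _ _ _ _ hk.symm]
    simp
  · simp
  · intro l' _ hl
    simp [hl]
  · simp

end RegisterState

section Protocols

variable {α β α' β' α'' β'' : Type u} [Fintype α] [DecidableEq α] [Fintype β] [DecidableEq β]
  [Fintype α'] [DecidableEq α'] [Fintype β'] [DecidableEq β']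
  [Fintype α''] [DecidableEq α''] [Fintype β''] [DecidableEq β'']

lemma IsLOCC.map_sum {Φ : Matrix (α × β) (α × β) ℂ → Matrix (α' × β') (α' × β') ℂ}
    (h : IsLOCC Φ) {ι : Type*} (S : Finset ι) (σ : ι → Matrix (α × β) (α × β) ℂ) :
    Φ (∑ i ∈ S, σ i) = ∑ i ∈ S, Φ (σ i) := by
  induction h with
  | done => rfl
  | alice γ K hK Φ hΦ ih =>
    simp only [Matrix.mul_sum, Matrix.sum_mul, ih]
    exact Finset.sum_comm
  | bob γ K hK Φ hΦ ih =>
    simp only [Matrix.mul_sum, Matrix.sum_mul, ih]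
    exact Finset.sum_comm

/-- Additivity lets the second protocol be performed after each outcome of the first one. -/
lemma IsLOCC.comp {Ψ : Matrix (α' × β') (α' × β') ℂ → Matrix (α'' × β'') (α'' × β'') ℂ}
    (hΨ : IsLOCC Ψ) {Φ : Matrix (α × β) (α × β) ℂ → Matrix (α' × β') (α' × β') ℂ}
    (h : IsLOCC Φ) : IsLOCC fun σ => Ψ (Φ σ) := by
  induction h with
  | done => exact hΨ
  | alice γ K hK Φ hΦ ih =>
    simp only [hΨ.map_sum]
    exact IsLOCC.alice γ K hK _ ih
  | bob γ K hK Φ hΦ ih =>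
    simp only [hΨ.map_sum]
    exact IsLOCC.bob γ K hK _ ih

lemma LOCCConvertible.trans {σ : Matrix (α × β) (α × β) ℂ} {τ : Matrix (α' × β') (α' × β') ℂ}
    {υ : Matrix (α'' × β'') (α'' × β'') ℂ} (h : LOCCConvertible σ τ) (h' : LOCCConvertible τ υ) :
    LOCCConvertible σ υ := by
  obtain ⟨Φ, hΦ, rfl⟩ := h
  obtain ⟨Ψ, hΨ, rfl⟩ := h'
  exact ⟨_, hΨ.comp hΦ, rfl⟩

/-- Bob measures and announces his outcome `j`, then Alice makes a measurement that depends on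
`j`, and both outcomes are discarded. -/
lemma LOCCConvertible.of_oneWay {J I : Type u} [Fintype J] [Fintype I] (L : J → Matrix β' β ℂ)
    (hL : ∑ j, (L j)ᴴ * L j = 1) (K : J → I → Matrix α' α ℂ)
    (hK : ∀ j, ∑ i, (K j i)ᴴ * K j i = 1) (σ : Matrix (α × β) (α × β) ℂ) :
    LOCCConvertible σ (∑ j, ∑ i, (K j i ⊗ₖ L j) * σ * (K j i ⊗ₖ L j)ᴴ) := by
  refine ⟨_, IsLOCC.bob (fun _ => β') L hL _ fun j =>
    IsLOCC.alice (fun _ => α') (K j) (hK j) _ fun i => IsLOCC.done, ?_⟩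
  refine Finset.sum_congr rfl fun j _ => Finset.sum_congr rfl fun i _ => ?_
  have h : K j i ⊗ₖ L j = (K j i ⊗ₖ (1 : Matrix β' β' ℂ)) * ((1 : Matrix α α ℂ) ⊗ₖ L j) := by
    rw [← Matrix.mul_kronecker_mul, Matrix.mul_one, Matrix.one_mul]
  simp only [id, h, Matrix.conjTranspose_mul, Matrix.mul_assoc]

variable {ι ι' : Type u} [Fintype ι] [DecidableEq ι] [Fintype ι'] [DecidableEq ι']

/-- Bob makes the measurement `L` and announces the outcome `j`, Alice makes the measurement `K j`
and, according to both outcomes, rewrites her register from `k` to `f j i k`. -/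
lemma LOCCConvertible.registerState_of_oneWay {J I : Type u} [Fintype J] [Fintype I]
    (L : J → Matrix β' β ℂ) (hL : ∑ j, (L j)ᴴ * L j = 1) (K : J → I → Matrix α' α ℂ)
    (hK : ∀ j, ∑ i, (K j i)ᴴ * K j i = 1) (f : J → I → ι → ι')
    (R : ι → Matrix (α × β) (α × β) ℂ) :
    LOCCConvertible (registerState R) (registerState fun l => ∑ j, ∑ i, ∑ k,
      if l = f j i k then (K j i ⊗ₖ L j) * R k * (K j i ⊗ₖ L j)ᴴ else 0) := by
  have h := LOCCConvertible.of_oneWay L hL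
    (fun j (x : I × ι) => Matrix.single (f j x.1 x.2) x.2 (1 : ℂ) ⊗ₖ K j x.1) (fun j => by
      simp only [Matrix.conjTranspose_kronecker, ← Matrix.mul_kronecker_mul,
        Matrix.conjTranspose_single, Matrix.single_mul_single_same, star_one, mul_one]
      -- Dephasing of the register, combined with a complete measurement, is complete.
      have h1 : (∑ k : ι, Matrix.single k k (1 : ℂ)) = 1 := Matrix.sum_single_one
      rw [← Matrix.one_kronecker_one, ← hK j, ← h1, Fintype.sum_prod_type_right]
      ext p q
      simp [Matrix.sum_apply, Matrix.kroneckerMap_apply, Finset.sum_mul_sum]) (registerState R)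
  simp only [registerState_conj, Fintype.sum_prod_type] at h
  simpa only [registerState_sum] using h

end Protocols

/-! ### Light cones of symmetric circuits -/

section Balls

variable {Λ : Type u} [MetricSpace Λ]

lemma dist_le_of_diam_le {Z : Finset Λ} {r : ℝ} (h : Metric.diam (Z : Set Λ) ≤ r) {x y : Λ}
    (hx : x ∈ Z) (hy : y ∈ Z) : dist x y ≤ r :=
  (Metric.dist_le_diam_of_mem Z.finite_toSet.isBounded hx hy).trans h

variable [Fintype Λ]

lemma mem_ballAbout {X : Finset Λ} {l : ℝ} {y : Λ} :
    y ∈ ballAbout X l ↔ ∃ x ∈ X, dist y x ≤ l := by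
  simp [ballAbout]

lemma ballAbout_mono (X : Finset Λ) {l l' : ℝ} (h : l ≤ l') : ballAbout X l ⊆ ballAbout X l' := by
  intro y hy
  obtain ⟨x, hx, hxy⟩ := mem_ballAbout.1 hy
  exact mem_ballAbout.2 ⟨x, hx, hxy.trans h⟩

lemma subset_ballAbout (X : Finset Λ) {l : ℝ} (h : 0 ≤ l) : X ⊆ ballAbout X l :=
  fun x hx => mem_ballAbout.2 ⟨x, hx, by rwa [dist_self]⟩

lemma ballAbout_ballAbout_subset (X : Finset Λ) (l l' : ℝ) :
    ballAbout (ballAbout X l) l' ⊆ ballAbout X (l + l') := by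
  intro y hy
  obtain ⟨x, hx, hxy⟩ := mem_ballAbout.1 hy
  obtain ⟨z, hz, hxz⟩ := mem_ballAbout.1 hx
  exact mem_ballAbout.2 ⟨z, hz, by linarith [dist_triangle y x z]⟩

lemma subset_ballAbout_of_diam_le {X Z : Finset Λ} {r : ℝ} (h : Metric.diam (Z : Set Λ) ≤ r)
    (hXZ : ¬Disjoint Z X) : Z ⊆ ballAbout X r := by
  obtain ⟨x, hxZ, hxX⟩ := Finset.not_disjoint_iff.1 hXZ
  exact fun y hy => mem_ballAbout.2 ⟨x, hxX, dist_le_of_diam_le h hy hxZ⟩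

end Balls

section Circuits

variable {Λ G : Type u} [Fintype Λ] [DecidableEq Λ] [CommGroup G] {d : Λ → ℕ} {U : ∀ x, G →* Matrix.unitaryGroup (Fin (d x)) ℂ}

/-- The operator of a gate on the whole system. -/
def SymmetricGate.toMatrix (a : SymmetricGate U) : Matrix (FullConfig d) (FullConfig d) ℂ :=
  embedRegion a.region a.op

lemma SymmetricGate.toMatrix_localOn (a : SymmetricGate U) : LocalOn a.region a.toMatrix :=
  ⟨a.op, rfl⟩

lemma SymmetricGate.toMatrix_mem_unitaryGroup (a : SymmetricGate U) :
    a.toMatrix ∈ Matrix.unitaryGroup (FullConfig d) ℂ := by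
  rw [Matrix.mem_unitaryGroup_iff', Matrix.star_eq_conjTranspose, toMatrix,
    embedRegion_conjTranspose, embedRegion_mul, ← Matrix.star_eq_conjTranspose,
    Matrix.mem_unitaryGroup_iff'.1 a.unitary, embedRegion_one]

/-- The products of gates taken from `S` that do not touch the region `X`. -/
def gatesAvoiding (S : Set (SymmetricGate U)) (X : Finset Λ) :
    Submonoid (Matrix (FullConfig d) (FullConfig d) ℂ) :=
  Submonoid.closure {M | ∃ a ∈ S, Disjoint a.region X ∧ a.toMatrix = M}

lemma gatesAvoiding_mono {S S' : Set (SymmetricGate U)} (h : S ⊆ S') {X X' : Finset Λ}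
    (hX : X ⊆ X') : gatesAvoiding S X' ≤ gatesAvoiding S' X := by
  refine Submonoid.closure_mono ?_
  rintro _ ⟨a, ha, hd, rfl⟩
  exact ⟨a, h ha, hd.mono_right hX, rfl⟩

lemma commute_of_mem_gatesAvoiding {S : Set (SymmetricGate U)} {X : Finset Λ}
    {W M : Matrix (FullConfig d) (FullConfig d) ℂ} (hW : W ∈ gatesAvoiding S X)
    (h : ∀ a ∈ S, Disjoint a.region X → Commute M a.toMatrix) : Commute M W := by
  have h1 : gatesAvoiding S X ≤ Submonoid.centralizer {M} := by
    refine Submonoid.closure_le.2 ?_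
    rintro _ ⟨a, ha, hd, rfl⟩
    exact Submonoid.mem_centralizer_iff.2 fun N hN => by
      rw [Set.mem_singleton_iff.1 hN]
      exact h a ha hd
  exact Submonoid.mem_centralizer_iff.1 (h1 hW) M rfl

lemma localOn_of_mem_gatesAvoiding {S : Set (SymmetricGate U)} {X : Finset Λ}
    {W : Matrix (FullConfig d) (FullConfig d) ℂ} (hW : W ∈ gatesAvoiding S X) : LocalOn Xᶜ W := by
  induction hW using Submonoid.closure_induction with
  | mem _ h =>
    obtain ⟨a, -, hd, rfl⟩ := h
    exact a.toMatrix_localOn.mono (Finset.subset_compl_iff_disjoint_right.2 hd)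
  | one => exact LocalOn.one
  | mul _ _ _ _ h h' => exact h.mul h'

lemma mem_unitaryGroup_of_mem_gatesAvoiding {S : Set (SymmetricGate U)} {X : Finset Λ}
    {W : Matrix (FullConfig d) (FullConfig d) ℂ} (hW : W ∈ gatesAvoiding S X) :
    W ∈ Matrix.unitaryGroup (FullConfig d) ℂ := by
  refine Submonoid.closure_le (S := Matrix.unitaryGroup (FullConfig d) ℂ).2 ?_ hW
  rintro _ ⟨a, -, -, rfl⟩
  exact a.toMatrix_mem_unitaryGroup

section LightCone

variable [MetricSpace Λ]

/-- A layer is a product of a unitary near `A`, one near `B`, and gates that touch neither `A`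
nor `B`. -/
lemma exists_layer_factorization {r : ℝ} {A B : Finset Λ}
    (hAB : Disjoint (ballAbout A r) (ballAbout B r)) (l : List (SymmetricGate U))
    (hl : l.Pairwise fun a b => Disjoint a.region b.region)
    (hd : ∀ a ∈ l, Metric.diam (a.region : Set Λ) ≤ r) :
    ∃ W ∈ gatesAvoiding {a | a ∈ l} (A ∪ B),
      ∃ VA ∈ Matrix.unitaryGroup (FullConfig d) ℂ, ∃ VB ∈ Matrix.unitaryGroup (FullConfig d) ℂ,
      LocalOn (ballAbout A r) VA ∧ LocalOn (ballAbout B r) VB ∧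
        (l.map SymmetricGate.toMatrix).prod = W * VA * VB := by
  induction l with
  | nil => exact ⟨1, one_mem _, 1, one_mem _, 1, one_mem _, LocalOn.one, LocalOn.one, by simp⟩
  | cons a l ih =>
    rw [List.pairwise_cons] at hl
    obtain ⟨W, hW, VA, hVA, VB, hVB, hA, hB, h⟩ := ih hl.2 fun b hb => hd b (.tail _ hb)
    have hW' : W ∈ gatesAvoiding {b | b ∈ a :: l} (A ∪ B) :=
      gatesAvoiding_mono (fun b hb => List.mem_cons_of_mem _ hb) subset_rfl hW
    have haW : Commute a.toMatrix W := commute_of_mem_gatesAvoiding hW fun b hb _ =>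
      a.toMatrix_localOn.commute b.toMatrix_localOn (hl.1 b hb)
    have hda := hd a List.mem_cons_self
    rw [List.map_cons, List.prod_cons, h]
    by_cases hA' : Disjoint a.region A
    · by_cases hB' : Disjoint a.region B
      · refine ⟨a.toMatrix * W, mul_mem (Submonoid.subset_closure
          ⟨a, List.mem_cons_self, Finset.disjoint_union_right.2 ⟨hA', hB'⟩, rfl⟩) hW',
          VA, hVA, VB, hVB, hA, hB, ?_⟩
        simp only [mul_assoc]
      · have hloc := a.toMatrix_localOn.mono (subset_ballAbout_of_diam_le hda hB')
        refine ⟨W, hW', VA, hVA, a.toMatrix * VB, mul_mem a.toMatrix_mem_unitaryGroup hVB,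
          hA, hloc.mul hB, ?_⟩
        rw [← mul_assoc, ← mul_assoc, haW.eq, mul_assoc W, (hloc.commute hA hAB.symm).eq]
        simp only [mul_assoc]
    · have hloc := a.toMatrix_localOn.mono (subset_ballAbout_of_diam_le hda hA')
      refine ⟨W, hW', a.toMatrix * VA, mul_mem a.toMatrix_mem_unitaryGroup hVA, VB, hVB,
        hloc.mul hA, hB, ?_⟩
      rw [← mul_assoc, ← mul_assoc, haW.eq]
      simp only [mul_assoc]

/-- The gates outside the light cones of `A` and `B` touch neither of the two regions, and they
can be moved to the end of the circuit. What remains is a product of two unitaries, on the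
neighbourhoods of `A` and of `B` that the light cones sweep out. -/
lemma exists_circuit_factorization {r : ℝ} (hr : 0 ≤ r) (V : List (SymmetricLayer U))
    (hd : ∀ L ∈ V, ∀ a ∈ L.gates, Metric.diam (a.region : Set Λ) ≤ r) (A B : Finset Λ)
    (hAB : Disjoint (ballAbout A (V.length * r)) (ballAbout B (V.length * r))) :
    ∃ W ∈ gatesAvoiding {a : SymmetricGate U | Metric.diam (a.region : Set Λ) ≤ r} (A ∪ B),
      ∃ VA ∈ Matrix.unitaryGroup (FullConfig d) ℂ, ∃ VB ∈ Matrix.unitaryGroup (FullConfig d) ℂ,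
      LocalOn (ballAbout A (V.length * r)) VA ∧ LocalOn (ballAbout B (V.length * r)) VB ∧
        circuitMatrix V = W * VA * VB := by
  induction V generalizing A B with
  | nil =>
    exact ⟨1, one_mem _, 1, one_mem _, 1, one_mem _, LocalOn.one, LocalOn.one, by
      simp [circuitMatrix]⟩
  | cons L V ih =>
    have hlen : ((L :: V).length : ℝ) * r = r + V.length * r := by
      rw [List.length_cons]
      push_cast
      ring
    have hVr : 0 ≤ (V.length : ℝ) * r := by positivity
    rw [hlen] at hAB ⊢
    have hsub : ∀ X : Finset Λ, ballAbout X r ⊆ ballAbout X (r + V.length * r) := fun X =>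
      ballAbout_mono X (by linarith)
    obtain ⟨D, hD, KA, hKA, KB, hKB, hA, hB, hL⟩ := exists_layer_factorization
      (hAB.mono (hsub A) (hsub B)) L.gates L.disjoint fun a ha => hd L List.mem_cons_self a ha
    obtain ⟨W, hW, VA, hVA, VB, hVB, hA', hB', hV⟩ := ih
      (fun L' hL' => hd L' (List.mem_cons_of_mem _ hL')) (ballAbout A r) (ballAbout B r)
      (hAB.mono (ballAbout_ballAbout_subset A _ _) (ballAbout_ballAbout_subset B _ _))
    have hA'' := hA'.mono (ballAbout_ballAbout_subset A _ _)
    have hB'' := hB'.mono (ballAbout_ballAbout_subset B _ _)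
    have hKAW : Commute KA W := commute_of_mem_gatesAvoiding hW fun a _ ha =>
      hA.commute a.toMatrix_localOn (Finset.disjoint_union_right.1 ha).1.symm
    have hKBW : Commute KB W := commute_of_mem_gatesAvoiding hW fun a _ ha =>
      hB.commute a.toMatrix_localOn (Finset.disjoint_union_right.1 ha).2.symm
    have hKBVA : Commute KB VA := (hB.mono (hsub B)).commute hA'' hAB.symm
    refine ⟨D * W, mul_mem
      (gatesAvoiding_mono (fun a ha => hd L List.mem_cons_self a ha) subset_rfl hD)
      (gatesAvoiding_mono subset_rfl (Finset.union_subset_union (subset_ballAbout A hr)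
        (subset_ballAbout B hr)) hW),
      KA * VA, mul_mem hKA hVA, KB * VB, mul_mem hKB hVB, (hA.mono (hsub A)).mul hA'',
      (hB.mono (hsub B)).mul hB'', ?_⟩
    have hV' : (V.map SymmetricLayer.toMatrix).prod = W * VA * VB := hV
    rw [circuitMatrix, List.map_cons, List.prod_cons, hV']
    refine (congrArg (· * _) hL).trans ?_
    calc D * KA * KB * (W * VA * VB) = D * KA * (KB * W) * VA * VB := by simp only [mul_assoc]
      _ = D * (KA * W) * (KB * VA) * VB := by rw [hKBW.eq]; simp only [mul_assoc]
      _ = D * W * (KA * VA) * (KB * VB) := by rw [hKAW.eq, hKBVA.eq]; simp only [mul_assoc]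

/-- If `C` is far from the sites outside `X ∪ C`, a gate that avoids `X` lies inside `C` or is
disjoint from `C`, and so it preserves the charge of `C`. -/
lemma commute_regionSymmetry_of_mem_gatesAvoiding {r : ℝ} {X C : Finset Λ}
    (hC : ∀ x ∈ C, ∀ y ∈ (X ∪ C)ᶜ, r < dist x y)
    {W : Matrix (FullConfig d) (FullConfig d) ℂ}
    (hW : W ∈ gatesAvoiding {a : SymmetricGate U | Metric.diam (a.region : Set Λ) ≤ r} X)
    (g : G) : Commute W (regionSymmetry U C g) := by
  refine (commute_of_mem_gatesAvoiding hW fun a ha hX => ?_).symm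
  by_cases hd : Disjoint a.region C
  · exact (regionSymmetry_localOn U C g).commute a.toMatrix_localOn hd.symm
  · obtain ⟨x, hxa, hxC⟩ := Finset.not_disjoint_iff.1 hd
    have hsub : a.region ⊆ C := by
      intro y hy
      by_contra hyC
      have h1 := hC x hxC y (by simp [hyC, Finset.disjoint_left.1 hX hy])
      exact (dist_le_of_diam_le ha hxa hy).not_gt h1
    -- Inside `C` the gate commutes with the symmetry of `Cᶜ`, which can therefore be cancelled
    -- from the global symmetry.
    have h1 : Commute a.toMatrix (regionSymmetry U C g * regionSymmetry U Cᶜ g) := by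
      rw [← regionSymmetry_union U C disjoint_compl_right, Finset.union_compl]
      exact a.symm g
    have h2 : Commute a.toMatrix (regionSymmetry U Cᶜ g⁻¹) :=
      a.toMatrix_localOn.commute (regionSymmetry_localOn U _ _) (disjoint_compl_right.mono_left hsub)
    have h3 := h1.mul_right h2
    rw [mul_assoc, regionSymmetry_mul, mul_inv_cancel, regionSymmetry_one, mul_one] at h3
    exact h3.symm

end LightCone

/-! ### The inverse circuit -/

/-- The inverse of a gate. -/
def SymmetricGate.inv (a : SymmetricGate U) : SymmetricGate U where
  region := a.region
  op := a.opᴴ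
  unitary := Unitary.star_mem a.unitary
  symm g := by
    rw [← embedRegion_conjTranspose]
    exact commute_regionSymmetry_conjTranspose a.symm g

/-- The inverse of a layer. -/
def SymmetricLayer.inv (L : SymmetricLayer U) : SymmetricLayer U where
  gates := (L.gates.map SymmetricGate.inv).reverse
  disjoint := by
    rw [List.pairwise_reverse, List.pairwise_map]
    exact L.disjoint.imp fun h => h.symm

lemma SymmetricLayer.inv_toMatrix (L : SymmetricLayer U) : L.inv.toMatrix = L.toMatrixᴴ := by
  rw [toMatrix, toMatrix, Matrix.conjTranspose_list_prod, inv, List.map_reverse, List.map_map,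
    List.map_map]
  congr 3
  funext a
  exact (embedRegion_conjTranspose _ _).symm

lemma circuitMatrix_inv (V : List (SymmetricLayer U)) :
    circuitMatrix (V.map SymmetricLayer.inv).reverse = (circuitMatrix V)ᴴ := by
  rw [circuitMatrix, circuitMatrix, Matrix.conjTranspose_list_prod, List.map_reverse, List.map_map,
    List.map_map]
  congr 3
  funext L
  exact L.inv_toMatrix

lemma CircuitRangeLE.inv [MetricSpace Λ] {V : List (SymmetricLayer U)} {R : ℝ}
    (h : CircuitRangeLE V R) : CircuitRangeLE (V.map SymmetricLayer.inv).reverse R := by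
  obtain ⟨r, hr, hd, hR⟩ := h
  refine ⟨r, hr, fun L hL a ha => ?_, by simpa using hR⟩
  rw [List.mem_reverse, List.mem_map] at hL
  obtain ⟨L', hL', rfl⟩ := hL
  rw [SymmetricLayer.inv, List.mem_reverse, List.mem_map] at ha
  obtain ⟨a', ha', rfl⟩ := ha
  exact hd L' hL' a' ha'

lemma circuitMatrix_mem_unitaryGroup (V : List (SymmetricLayer U)) :
    circuitMatrix V ∈ Matrix.unitaryGroup (FullConfig d) ℂ := by
  refine Submonoid.list_prod_mem _ fun M hM => ?_
  obtain ⟨L, -, rfl⟩ := List.mem_map.1 hM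
  refine Submonoid.list_prod_mem _ fun M hM => ?_
  obtain ⟨a, -, rfl⟩ := List.mem_map.1 hM
  exact a.toMatrix_mem_unitaryGroup

end Circuits

/-! ### The register of the total charge -/

section Register

variable {Λ G : Type u} [Fintype Λ] [DecidableEq Λ] [CommGroup G] {d : Λ → ℕ}
  {U : ∀ x, G →* Matrix.unitaryGroup (Fin (d x)) ℂ}

lemma Omega_eq_registerState (A B C : Finset Λ) (ρ : Matrix (FullConfig d) (FullConfig d) ℂ) :
    Omega U A B C ρ
      = registerState fun κ : Charge U C => reduceTo A B (chargeProj U C κ.val * ρ) := rfl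

section IsState

lemma registerState_posSemidef {α β ι : Type u} [Finite α] [Finite β] [Finite ι]
    [DecidableEq ι] {R : ι → Matrix (α × β) (α × β) ℂ} (h : ∀ k, (R k).PosSemidef) :
    (registerState R).PosSemidef := by
  have := Fintype.ofFinite ι
  have := Fintype.ofFinite α
  have := Fintype.ofFinite β
  rw [registerState_eq_sum]
  refine Matrix.posSemidef_sum _ fun k _ => Matrix.PosSemidef.submatrix ?_ _
  refine Matrix.PosSemidef.kronecker ?_ (h k)
  rw [← Matrix.diagonal_single]
  exact Matrix.PosSemidef.diagonal (Pi.single_nonneg.2 zero_le_one)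

lemma reduceTo_posSemidef {A B : Finset Λ} {M : Matrix (FullConfig d) (FullConfig d) ℂ}
    (h : M.PosSemidef) : (reduceTo A B M).PosSemidef := by
  have h1 : reduceTo A B M = ∑ e : Config d (A ∪ B)ᶜ,
      M.submatrix (fun p => glue A B p.1 p.2 e) (fun p => glue A B p.1 p.2 e) := by
    ext p q
    simp [reduceTo, Matrix.sum_apply]
  rw [h1]
  exact Matrix.posSemidef_sum _ fun e _ => h.submatrix _

lemma trace_reduceTo {A B : Finset Λ} (hAB : Disjoint A B)
    (M : Matrix (FullConfig d) (FullConfig d) ℂ) : (reduceTo A B M).trace = M.trace := by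
  let φ : (Config d A × Config d B) × Config d (A ∪ B)ᶜ ≃ FullConfig d :=
    { toFun := fun p => glue A B p.1.1 p.1.2 p.2
      invFun := fun s => ((fun x => s x, fun x => s x), fun x => s x)
      left_inv := fun p => Prod.ext
        (Prod.ext (restrict_glue_left _ _ _) (restrict_glue_right _ _ _ hAB))
        (restrict_glue_compl _ _ _)
      right_inv := fun s => by
        funext x
        simp only [glue]
        split_ifs <;> rfl }
  simp only [Matrix.trace, Matrix.diag_apply, reduceTo, Matrix.of_apply]
  rw [← φ.sum_comp]
  exact (Fintype.sum_prod_type fun p => M (φ p) (φ p)).symm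

/-- The charge register together with the regions `A` and `B` is in a state. -/
lemma Omega_isState {A B C : Finset Λ} (hAB : Disjoint A B) (hAC : Disjoint A C)
    (hBC : Disjoint B C) {ρ : Matrix (FullConfig d) (FullConfig d) ℂ}
    [Nonempty (FullConfig d)] (hρ : IsState ρ) : IsState (Omega U A B C ρ) := by
  have hC : C ⊆ (A ∪ B)ᶜ :=
    Finset.subset_compl_iff_disjoint_left.2 (Finset.disjoint_union_left.2 ⟨hAC, hBC⟩)
  rw [Omega_eq_registerState]
  constructor
  · refine registerState_posSemidef fun κ => ?_
    -- `C` is traced out, so `Π ρ = Π Π ρ` has the same partial trace as `Π ρ Π`, which is positive.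
    rw [← chargeProj_mul_self, mul_assoc,
      reduceTo_mul_comm ((chargeProj_localOn κ.val).mono hC)]
    nth_rw 2 [← chargeProj_conjTranspose]
    exact reduceTo_posSemidef (hρ.1.mul_mul_conjTranspose_same _)
  · have h1 : (registerState fun κ : Charge U C =>
        reduceTo A B (chargeProj U C κ.val * ρ)).trace
        = ∑ κ : Charge U C, (reduceTo A B (chargeProj U C κ.val * ρ)).trace := by
      simp only [Matrix.trace, Matrix.diag_apply, registerState, Matrix.of_apply, if_true,
        Fintype.sum_prod_type]
    rw [h1]
    simp only [trace_reduceTo hAB]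
    rw [← Matrix.trace_sum, ← Finset.sum_mul, sum_chargeProj, one_mul, hρ.2]

end IsState

/-- The Kraus operators of the following measurement on `Y`: apply the unitary `V`, then measure
the charge of the part `X` of `Y`. -/
lemma exists_chargeMeasurement [Nonempty (FullConfig d)] {X Y : Finset Λ} (hXY : X ⊆ Y)
    {V : Matrix (FullConfig d) (FullConfig d) ℂ} (hV : V ∈ Matrix.unitaryGroup (FullConfig d) ℂ)
    (hVY : LocalOn Y V) :
    ∃ N : Charge U X → Matrix (Config d Y) (Config d Y) ℂ,
      (∀ κ, embedRegion Y (N κ) = chargeProj U X κ.val * V) ∧ ∑ κ, (N κ)ᴴ * N κ = 1 := by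
  choose N hN using fun κ : Charge U X => ((chargeProj_localOn κ.val).mono hXY).mul hVY
  refine ⟨N, hN, embedRegion_injective Y ?_⟩
  rw [embedRegion_sum, embedRegion_one]
  have h : ∀ κ, embedRegion Y ((N κ)ᴴ * N κ) = Vᴴ * chargeProj U X κ.val * V := by
    intro κ
    rw [← embedRegion_mul, ← embedRegion_conjTranspose, hN, Matrix.conjTranspose_mul,
      chargeProj_conjTranspose, mul_assoc, ← mul_assoc (chargeProj U X κ.val),
      chargeProj_mul_self, mul_assoc]
  simp only [h]
  rw [← Finset.sum_mul, ← Finset.mul_sum, sum_chargeProj, mul_one]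
  exact Matrix.mem_unitaryGroup_iff'.1 hV

instance [Nonempty (FullConfig d)] (X : Finset Λ) : Nonempty (Charge U X) := by
  by_contra h
  rw [not_nonempty_iff] at h
  have h1 := sum_chargeProj U X
  rw [Fintype.sum_empty] at h1
  exact zero_ne_one h1

open Classical in
/-- The charge `κ`, if it occurs in `X`, and an arbitrary charge that occurs in `X` otherwise. -/
noncomputable def Charge.ofHom [Nonempty (FullConfig d)] (U : ∀ x, G →* Matrix.unitaryGroup (Fin (d x)) ℂ)
    (X : Finset Λ) (κ : G →* Circle) : Charge U X :=
  if h : chargeSpace U X κ ≠ ⊥ then ⟨κ, h⟩ else Classical.arbitrary _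

/-- If `M` has charge `κ` in `X`, then the measurement of the charge of `X` gives `κ`. If `κ` does
not occur in `X`, then `M = 0`, so that the value of `Charge.ofHom` does not matter. -/
lemma chargeProj_mul_eq_ite [Nonempty (FullConfig d)] {X : Finset Λ} {κ : G →* Circle}
    {M : Matrix (FullConfig d) (FullConfig d) ℂ} (hM : chargeProj U X κ * M = M)
    (l : Charge U X) :
    chargeProj U X l.val * M = if l = Charge.ofHom U X κ then M else 0 := by
  by_cases h : chargeSpace U X κ = ⊥
  · rw [chargeProj_eq_zero h, zero_mul] at hM
    simp [← hM]
  · have h1 : Charge.ofHom U X κ = ⟨κ, h⟩ := dif_pos h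
    rw [h1]
    split_ifs with hl
    · rw [hl, hM]
    · rw [← hM, ← mul_assoc, chargeProj_mul_of_ne fun h' => hl (Subtype.ext h'), zero_mul]

/-- Charge measurements on parts `X` and `Y` of the regions `A'` and `B'` may be made after all
unitaries, and be replaced by projections on one side of the state, as `X` and `Y` are traced
out. -/
lemma reduceTo_chargeProj_conj [Nonempty (FullConfig d)] {A B A' B' C X Y : Finset Λ}
    (hX : X ⊆ A') (hY : Y ⊆ B') (hAB : Disjoint A' B') (hCA : Disjoint C A') (hCB : Disjoint C B')
    (hX' : X ⊆ (A ∪ B)ᶜ) (hY' : Y ⊆ (A ∪ B)ᶜ)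
    {P VA VB : Matrix (FullConfig d) (FullConfig d) ℂ} (hP : LocalOn C P)
    (hVA : LocalOn A' VA) (hVB : LocalOn B' VB) (κ κ' : G →* Circle)
    (ρ : Matrix (FullConfig d) (FullConfig d) ℂ) :
    reduceTo A B (chargeProj U X κ * VA * (chargeProj U Y κ' * VB) * (P * ρ) *
        (chargeProj U X κ * VA * (chargeProj U Y κ' * VB))ᴴ)
      = reduceTo A B (P * (chargeProj U X κ * chargeProj U Y κ') *
          ((VA * VB) * ρ * (VA * VB)ᴴ)) := by
  have hPA' : LocalOn X (chargeProj U X κ) := chargeProj_localOn _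
  have hPB' : LocalOn Y (chargeProj U Y κ') := chargeProj_localOn _
  have hF : (chargeProj U X κ * chargeProj U Y κ')ᴴ = chargeProj U X κ * chargeProj U Y κ' := by
    rw [Matrix.conjTranspose_mul, chargeProj_conjTranspose, chargeProj_conjTranspose,
      (hPA'.commute hPB' (hAB.mono hX hY)).eq]
  have hFF : chargeProj U X κ * chargeProj U Y κ' * (chargeProj U X κ * chargeProj U Y κ')
      = chargeProj U X κ * chargeProj U Y κ' := by
    rw [mul_assoc, ← mul_assoc (chargeProj U Y κ'), ← (hPA'.commute hPB' (hAB.mono hX hY)).eq,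
      mul_assoc _ (chargeProj U Y κ'), chargeProj_mul_self, ← mul_assoc, chargeProj_mul_self]
  have hQ : chargeProj U X κ * VA * (chargeProj U Y κ' * VB)
      = chargeProj U X κ * chargeProj U Y κ' * (VA * VB) := by
    rw [mul_assoc, ← mul_assoc VA, (hVA.commute hPB' (hAB.mono_right hY)).eq]
    simp only [mul_assoc]
  have hPF : Commute P (chargeProj U X κ * chargeProj U Y κ') :=
    (hP.commute hPA' (hCA.mono_right hX)).mul_right (hP.commute hPB' (hCB.mono_right hY))
  have hFloc : LocalOn (A ∪ B)ᶜ (chargeProj U X κ * chargeProj U Y κ') :=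
    (hPA'.mono hX').mul (hPB'.mono hY')
  rw [hQ]
  generalize chargeProj U X κ * chargeProj U Y κ' = F at *
  have hPV : Commute P (VA * VB) := (hP.commute hVA hCA).mul_right (hP.commute hVB hCB)
  generalize VA * VB = V at *
  rw [Matrix.conjTranspose_mul, hF, ← mul_assoc, ← reduceTo_mul_comm hFloc]
  congr 1
  calc F * (F * V * (P * ρ) * Vᴴ) = F * F * (V * P) * ρ * Vᴴ := by simp only [mul_assoc]
    _ = F * P * V * ρ * Vᴴ := by
      rw [hFF, ← hPV.eq]
      simp only [mul_assoc]
    _ = P * F * (V * ρ * Vᴴ) := by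
      rw [← hPF.eq]
      simp only [mul_assoc]

/-- A unitary outside `A` and `B` that preserves the charge of `C` does not affect the joint state
of `A`, `B` and the charge of `C`. -/
lemma reduceTo_chargeProj_outer {A B C : Finset Λ}
    {VA VB W : Matrix (FullConfig d) (FullConfig d) ℂ}
    (hW : W ∈ Matrix.unitaryGroup (FullConfig d) ℂ) (hW' : LocalOn (A ∪ B)ᶜ W)
    (hWC : ∀ g, Commute W (regionSymmetry U C g)) (κ : G →* Circle)
    (ρ : Matrix (FullConfig d) (FullConfig d) ℂ) :
    reduceTo A B (chargeProj U C κ * ((W * VA * VB) * ρ * (W * VA * VB)ᴴ))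
      = reduceTo A B (chargeProj U C κ * ((VA * VB) * ρ * (VA * VB)ᴴ)) := by
  have hWP : Commute W (chargeProj U C κ) := commute_chargeProj hWC
  have h1 : chargeProj U C κ * ((W * VA * VB) * ρ * (W * VA * VB)ᴴ)
      = W * (chargeProj U C κ * ((VA * VB) * ρ * (VA * VB)ᴴ) * Wᴴ) := by
    rw [mul_assoc W VA VB, Matrix.conjTranspose_mul W]
    simp only [← mul_assoc]
    rw [hWP.eq]
  rw [h1, reduceTo_mul_comm hW', mul_assoc, ← Matrix.star_eq_conjTranspose W,
    Matrix.mem_unitaryGroup_iff'.1 hW, mul_one]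

/-- The two parties, who hold the larger regions `A'` and `B'` and the charge of the rest of `C`,
can apply the unitary `W * VA * VB`: Alice and Bob apply `VA` and `VB`, measure the charges of
their parts of `C`, and discard the sites outside `A` and `B`. Alice multiplies the charges they
found to the one in her register. The unitary `W` affects neither the charge of `C` nor the state
of `A` and `B`. -/
lemma LOCCConvertible.Omega_conj [Nonempty (FullConfig d)] {A B C A' B' : Finset Λ}
    (hA : A ⊆ A') (hB : B ⊆ B') (hAB : Disjoint A' B') (hAC : Disjoint A C) (hBC : Disjoint B C)
    {VA VB W : Matrix (FullConfig d) (FullConfig d) ℂ}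
    (hVA : VA ∈ Matrix.unitaryGroup (FullConfig d) ℂ) (hVA' : LocalOn A' VA)
    (hVB : VB ∈ Matrix.unitaryGroup (FullConfig d) ℂ) (hVB' : LocalOn B' VB)
    (hW : W ∈ Matrix.unitaryGroup (FullConfig d) ℂ) (hW' : LocalOn (A ∪ B)ᶜ W)
    (hWC : ∀ g, Commute W (regionSymmetry U C g))
    (ρ : Matrix (FullConfig d) (FullConfig d) ℂ) :
    LOCCConvertible (Omega U A' B' (C \ (A' ∪ B')) ρ)
      (Omega U A B C ((W * VA * VB) * ρ * (W * VA * VB)ᴴ)) := by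
  have hC : C ⊆ (A ∪ B)ᶜ :=
    Finset.subset_compl_iff_disjoint_left.2 (Finset.disjoint_union_left.2 ⟨hAC, hBC⟩)
  set C₀ := C \ (A' ∪ B') with hC₀
  have hCA' : Disjoint C₀ A' :=
    Finset.sdiff_disjoint.mono_right Finset.subset_union_left
  have hCB' : Disjoint C₀ B' :=
    Finset.sdiff_disjoint.mono_right Finset.subset_union_right
  have hCAB : Disjoint (C ∩ A') (C ∩ B') :=
    hAB.mono Finset.inter_subset_right Finset.inter_subset_right
  have hC₀AB : Disjoint C₀ (C ∩ A' ∪ C ∩ B') := Finset.disjoint_union_right.2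
    ⟨hCA'.mono_right Finset.inter_subset_right, hCB'.mono_right Finset.inter_subset_right⟩
  have hCeq : C₀ ∪ (C ∩ A' ∪ C ∩ B') = C := by
    rw [hC₀, ← Finset.inter_union_distrib_left, Finset.sdiff_union_inter]
  obtain ⟨NA, hNA, hNA1⟩ := exists_chargeMeasurement (U := U) (X := C ∩ A')
    Finset.inter_subset_right hVA hVA'
  obtain ⟨NB, hNB, hNB1⟩ := exists_chargeMeasurement (U := U) (X := C ∩ B')
    Finset.inter_subset_right hVB hVB'
  -- The Kraus operators of the two parties; `e` is the discarded configuration.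
  obtain ⟨KA, hKA⟩ : ∃ KA : Charge U (C ∩ A') → Config d (A' \ A) →
    Matrix (Config d A) (Config d A') ℂ, ∀ κ e, KA κ e = contraction hA e * NA κ :=
    ⟨_, fun _ _ => rfl⟩
  obtain ⟨KB, hKB⟩ : ∃ KB : Charge U (C ∩ B') → Config d (B' \ B) →
    Matrix (Config d B) (Config d B') ℂ, ∀ κ e, KB κ e = contraction hB e * NB κ :=
    ⟨_, fun _ _ => rfl⟩
  have hloc := LOCCConvertible.registerState_of_oneWay
    (fun j : Charge U (C ∩ B') × Config d (B' \ B) => KB j.1 j.2)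
    (by simpa only [hKB] using sum_contraction_mul hB hNB1)
    (fun _ (i : Charge U (C ∩ A') × Config d (A' \ A)) => KA i.1 i.2)
    (fun _ => by simpa only [hKA] using sum_contraction_mul hA hNA1)
    (fun j i (k : Charge U C₀) => Charge.ofHom U C (k.val * (i.1.val * j.1.val)))
    (fun k => reduceTo A' B' (chargeProj U C₀ k.val * ρ))
  rw [Omega_eq_registerState, Omega_eq_registerState]
  refine Eq.mp (congrArg _ (congrArg _ (funext fun l => ?_))) hloc
  have hterm : ∀ (κB : Charge U (C ∩ B')) (κA : Charge U (C ∩ A')) (k : Charge U C₀),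
      ∑ eA, ∑ eB, (KA κA eA ⊗ₖ KB κB eB) * reduceTo A' B' (chargeProj U C₀ k.val * ρ) *
        (KA κA eA ⊗ₖ KB κB eB)ᴴ
      = reduceTo A B (chargeProj U C₀ k.val *
          (chargeProj U (C ∩ A') κA.val * chargeProj U (C ∩ B') κB.val) *
          ((VA * VB) * ρ * (VA * VB)ᴴ)) := by
    intro κB κA k
    rw [sum_contraction_mul_conj_reduceTo hA hB hAB _ _ _ _ (hKA κA) (hKB κB), hNA, hNB]
    exact reduceTo_chargeProj_conj Finset.inter_subset_right Finset.inter_subset_right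
      hAB hCA' hCB' (Finset.inter_subset_left.trans hC) (Finset.inter_subset_left.trans hC)
      (chargeProj_localOn _) hVA' hVB' _ _ ρ
  have hcharge : ∀ (κB : Charge U (C ∩ B')) (κA : Charge U (C ∩ A')) (k : Charge U C₀),
      chargeProj U C (k.val * (κA.val * κB.val)) * (chargeProj U C₀ k.val *
        (chargeProj U (C ∩ A') κA.val * chargeProj U (C ∩ B') κB.val))
      = chargeProj U C₀ k.val *
        (chargeProj U (C ∩ A') κA.val * chargeProj U (C ∩ B') κB.val) := by
    intro κB κA k
    have h1 := chargeProj_union_mul (U := U) hC₀AB k.val (κA.val * κB.val)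
    rw [hCeq] at h1
    rw [← chargeProj_union_mul hCAB, ← mul_assoc (chargeProj U C₀ k.val), ← mul_assoc, h1]
  have hsum : chargeProj U C l.val = ∑ κB : Charge U (C ∩ B'), ∑ κA : Charge U (C ∩ A'),
      ∑ k : Charge U C₀, chargeProj U C l.val * (chargeProj U C₀ k.val *
        (chargeProj U (C ∩ A') κA.val * chargeProj U (C ∩ B') κB.val)) := by
    simp only [← Finset.mul_sum, ← Finset.sum_mul, sum_chargeProj, one_mul, mul_one]
  -- Both sides are sums over the three charges. Those whose product is not `l` contribute zero.
  rw [reduceTo_chargeProj_outer hW hW' hWC, hsum]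
  simp only [Finset.sum_mul, reduceTo_sum, Fintype.sum_prod_type]
  refine Finset.sum_congr rfl fun κB _ => ?_
  rw [Finset.sum_comm]
  refine Finset.sum_congr rfl fun κA _ => ?_
  simp only [chargeProj_mul_eq_ite (hcharge κB κA _)]
  rw [Finset.sum_congr rfl fun eB _ => Finset.sum_comm, Finset.sum_comm]
  refine Finset.sum_congr rfl fun k _ => ?_
  split_ifs with hl
  · rw [← hterm, Finset.sum_comm]
  · simp only [Finset.sum_const_zero, zero_mul, reduceTo_zero]

end Register

/-! ### Invariance of the SPT-entanglement -/

section Invariance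

lemma CircuitRangeLE.exists_le {Λ G : Type u} [Fintype Λ] [DecidableEq Λ] [MetricSpace Λ]
    [CommGroup G] {d : Λ → ℕ} {U : ∀ x, G →* Matrix.unitaryGroup (Fin (d x)) ℂ}
    {V : List (SymmetricLayer U)} {R : ℝ} (h : CircuitRangeLE V R) :
    ∃ r : ℝ, 0 ≤ r ∧ r ≤ R ∧ (∀ L ∈ V, ∀ a ∈ L.gates, Metric.diam (a.region : Set Λ) ≤ r) ∧
      (V.length : ℝ) * r ≤ R := by
  obtain ⟨r, hr, hd, hR⟩ := h
  -- A circuit of depth zero does not bound `r`, so `r` is replaced by `0` in this case.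
  rcases V.eq_nil_or_concat with rfl | ⟨V', L, rfl⟩
  · exact ⟨0, le_rfl, by simpa using hR, by simp, by simpa using hR⟩
  · refine ⟨r, hr, le_trans ?_ hR, hd, hR⟩
    refine le_mul_of_one_le_left hr ?_
    simp

variable {Λ G : Type u} [Fintype Λ] [DecidableEq Λ] [MetricSpace Λ] [CommGroup G] {d : Λ → ℕ}
  {U : ∀ x, G →* Matrix.unitaryGroup (Fin (d x)) ℂ} {A B C : Finset Λ}

/-- Homogeneity gives the parties the larger regions, on which they can simulate the part of the
circuit that matters for `A`, `B` and the charge of `C`. -/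
lemma LOCCConvertible.Omega_circuit [Nonempty (FullConfig d)] (hAC : Disjoint A C)
    (hBC : Disjoint B C) {R l : ℝ} {V : List (SymmetricLayer U)} (hV : CircuitRangeLE V R)
    (hl : 2 * R < l) (hC : ∀ x ∈ C, ∀ y ∈ (A ∪ B ∪ C)ᶜ, 2 * R < dist x y)
    {ρ : Matrix (FullConfig d) (FullConfig d) ℂ} (hρ : IsHomogeneousAt U A B C l ρ) :
    LOCCConvertible (Omega U A B C ρ)
      (Omega U A B C (circuitMatrix V * ρ * (circuitMatrix V)ᴴ)) := by
  obtain ⟨r, hr, hrR, hd, hVr⟩ := hV.exists_le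
  have hRl : V.length * r ≤ l := by linarith
  obtain ⟨W, hW, VA, hVA, VB, hVB, hA, hB, hfac⟩ := exists_circuit_factorization hr V hd A B
    (hρ.1.mono (ballAbout_mono A hRl) (ballAbout_mono B hRl))
  rw [hfac]
  exact hρ.2.trans (LOCCConvertible.Omega_conj (subset_ballAbout A (by linarith))
    (subset_ballAbout B (by linarith)) hρ.1 hAC hBC hVA (hA.mono (ballAbout_mono A hRl)) hVB
    (hB.mono (ballAbout_mono B hRl)) (mem_unitaryGroup_of_mem_gatesAvoiding hW)
    (localOn_of_mem_gatesAvoiding hW)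
    (commute_regionSymmetry_of_mem_gatesAvoiding
      (fun x hx y hy => by linarith [hC x hx y hy]) hW) ρ)

lemma IsState.nonempty {ι : Type*} [Fintype ι] {ρ : Matrix ι ι ℂ} (h : IsState ρ) :
    Nonempty ι := by
  by_contra hn
  rw [not_nonempty_iff] at hn
  have h1 := h.2
  rw [Matrix.trace, Fintype.sum_empty] at h1
  exact zero_ne_one h1

end Invariance

theorem mainTheorem3 {Λ G : Type u} [Fintype Λ] [DecidableEq Λ] [MetricSpace Λ] [CommGroup G]
    (d : Λ → ℕ) (U : ∀ x, G →* Matrix.unitaryGroup (Fin (d x)) ℂ)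
    (A B C : Finset Λ) (hAB : Disjoint A B) (hAC : Disjoint A C) (hBC : Disjoint B C)
    (ρ₁ ρ₂ : Matrix (FullConfig d) (FullConfig d) ℂ) (hρ₁ : IsState ρ₁) (hρ₂ : IsState ρ₂)
    (R : ℝ) (V : List (SymmetricLayer U)) (hVR : CircuitRangeLE V R)
    (hV : circuitMatrix V * ρ₁ * (circuitMatrix V)ᴴ = ρ₂)
    (hom₁ : ∃ l : ℝ, 2 * R < l ∧ IsHomogeneousAt U A B C l ρ₁)
    (hom₂ : ∃ l : ℝ, 2 * R < l ∧ IsHomogeneousAt U A B C l ρ₂)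
    (hCD : ∀ x ∈ C, ∀ y ∈ (A ∪ B ∪ C)ᶜ, 2 * R < dist x y) :
    LOCCConvertible (Omega U A B C ρ₁) (Omega U A B C ρ₂) ∧
      LOCCConvertible (Omega U A B C ρ₂) (Omega U A B C ρ₁) ∧
      ∀ E : BipartiteFunctional.{u}, IsEntanglementMeasure E →
        sptEntanglement E U A B C ρ₁ = sptEntanglement E U A B C ρ₂ := by
  have := hρ₁.nonempty
  have h12 : LOCCConvertible (Omega U A B C ρ₁) (Omega U A B C ρ₂) := by
    obtain ⟨l, hl, hom⟩ := hom₁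
    rw [← hV]
    exact LOCCConvertible.Omega_circuit hAC hBC hVR hl hCD hom
  have hV' : circuitMatrix (V.map SymmetricLayer.inv).reverse * ρ₂ *
      (circuitMatrix (V.map SymmetricLayer.inv).reverse)ᴴ = ρ₁ := by
    have hU : (circuitMatrix V)ᴴ * circuitMatrix V = 1 :=
      Matrix.mem_unitaryGroup_iff'.1 (circuitMatrix_mem_unitaryGroup V)
    rw [circuitMatrix_inv, Matrix.conjTranspose_conjTranspose, ← hV]
    calc (circuitMatrix V)ᴴ * (circuitMatrix V * ρ₁ * (circuitMatrix V)ᴴ) * circuitMatrix V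
        = ((circuitMatrix V)ᴴ * circuitMatrix V) * ρ₁ * ((circuitMatrix V)ᴴ * circuitMatrix V) := by
          simp only [mul_assoc]
      _ = ρ₁ := by rw [hU, one_mul, mul_one]
  have h21 : LOCCConvertible (Omega U A B C ρ₂) (Omega U A B C ρ₁) := by
    obtain ⟨l, hl, hom⟩ := hom₂
    rw [← hV']
    exact LOCCConvertible.Omega_circuit hAC hBC hVR.inv hl hCD hom
  have hs₁ := Omega_isState (U := U) hAB hAC hBC hρ₁
  have hs₂ := Omega_isState (U := U) hAB hAC hBC hρ₂
  exact ⟨h12, h21, fun E hE => le_antisymm (hE _ _ _ _ _ _ hs₂ hs₁ h21)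
    (hE _ _ _ _ _ _ hs₁ hs₂ h12)⟩
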